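/- An origami (square-tiled surface) is a closed connected surface $X$ obtained from finitely many unit squares by gluing, via translations, each right side to a left side and each top side to a bottom side. It comes with a cover $\pi\colon X\to\mathbb{T}=\mathbb{R}^2/\mathbb{Z}^2$ branched at most over the origin and with the abelian differential $\omega=\pi^*\mathrm{d}z$, which has a zero of order $m$ at a point exactly when the total angle around that point is $2\pi(m+1)$. The origami is regular if $\pi$ is a normal cover. Its translation group is the group of automorphisms $f$ of $X$ with $f^*\omega=\omega$. For $k \ge 1$, it lies in the stratum $\mathcal{H}(k^{s})$ if $\omega$ has exactly $s$ zeros, all of order $k$. Let $k\geq 1$ be an odd integer and let $q$ be an odd prime. Then regular origamis exist in the stratum $\mathcal{H}(k^{2q})$ if and only if $q=3$ and either: - $k\equiv 1 \pmod 4$ and every prime factor of $(k+1)/2$ is congruent to $1$ modulo $3$; or - $k\equiv 3 \pmod 4$ and every prime factor of $(k+1)/4$ is congruent to $1$ modulo $3$. Moreover, the translation group of any regular origami in $\mathcal{H}(k^{2q})$ is isomorphic to a semidirect product $(\mathbb{Z}/\lambda\mathbb{Z}\times\mathbb{Z}/2\mathbb{Z}\times\mathbb{Z}/2\mathbb{Z})\rtimes\mathbb{Z}/3\mathbb{Z}$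 with $\lambda=(k+1)/2$ if $k\equiv 1\pmod 4$, and to a semidirect product $(\mathbb{Z}/\lambda\mathbb{Z}\times \mathrm{Q}_8)\rtimes\mathbb{Z}/3\mathbb{Z}$ with $\lambda=(k+1)/4$ if $k\equiv 3\pmod 4$, where $\mathrm{Q}_8$ is the quaternion group of order $8$. The same holds in group-theoretic form: a group $G$ of order $2(k+1)q$ with two generators $x,y$ such that $[x,y]=xyx^{-1}y^{-1}$ has order $k+1$ exists if and only if $q=3$ and one of the two conditions above holds, and any such $G$ is isomorphic to a semidirect product of the first form if $k\equiv 1\pmod 4$, and of the second form if $k\equiv 3\pmod 4$. -/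

import Mathlib

universe u

/-- The data of a square-tiled surface (origami): one unit square for each element of `S`.
The right side of the square `s` is glued by a translation to the left side of `right s`, and its
top side to the bottom side of `up s`; the result has to be connected. -/
structure Origami (S : Type u) where
  right : Equiv.Perm S
  up : Equiv.Perm S
  nonempty : Nonempty S
  connected : ∀ s t : S, ∃ g ∈ Subgroup.closure {right, up}, g s = t

namespace Origami

variable {S : Type u}

/-- The disjoint union of the unit squares `[0,1] × [0,1]` indexed by `S`. -/
abbrev Squares (S : Type u) : Type u := (_ : S) × (unitInterval × unitInterval)

/-- The side identifications. -/
inductive Glue (O : Origami S) : Squares S → Squares S → Prop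
  | right (s : S) (t : unitInterval) : Glue O ⟨s, (1, t)⟩ ⟨O.right s, (0, t)⟩
  | up (s : S) (t : unitInterval) : Glue O ⟨s, (t, 1)⟩ ⟨O.up s, (t, 0)⟩

/-- The closed surface obtained from the squares by the side identifications. -/
def Surface (O : Origami S) : Type u := Quot O.Glue

instance (O : Origami S) : TopologicalSpace O.Surface :=
  inferInstanceAs (TopologicalSpace (Quot O.Glue))

/-- The unit square torus `ℝ² / ℤ²`. -/
abbrev Torus : Type := UnitAddCircle × UnitAddCircle

/-- The cover of the unit torus, branched at most over the origin. The abelian differential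
of the origami is the pull-back of `dz` under it. -/
def proj (O : Origami S) : O.Surface → Torus :=
  Quot.lift (fun p => (((p.2.1 : ℝ) : UnitAddCircle), ((p.2.2 : ℝ) : UnitAddCircle))) (by
    have h : ((1 : ℝ) : UnitAddCircle) = 0 := AddCircle.coe_period 1
    intro a b hab
    cases hab <;> simp [h])

open Classical in
/-- The angle that the unit square fills at its point `z`: `2π` at an interior point, `π` at an
interior point of a side, `π / 2` at a corner. -/
noncomputable def squareAngle (z : unitInterval × unitInterval) : ℝ :=
  2 * Real.pi * (if z.1 = 0 ∨ z.1 = 1 then 1 / 2 else 1) * (if z.2 = 0 ∨ z.2 = 1 then 1 / 2 else 1)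

/-- The total angle of the flat metric around a point of the surface. -/
noncomputable def coneAngle (O : Origami S) (P : O.Surface) : ℝ :=
  ∑ᶠ a ∈ {a : Squares S | Quot.mk O.Glue a = P}, squareAngle a.2

/-- The differential has a zero of order `m` at `P` if and only if the total angle around `P`
is `2π (m + 1)`; order `0` means that it does not vanish at `P`. -/
def HasOrder (O : Origami S) (P : O.Surface) (m : ℕ) : Prop :=
  O.coneAngle P = 2 * Real.pi * (m + 1)

/-- The origami lies in the stratum `H(k ^ n)` (for `k ≥ 1`): its differential has exactly `n`
zeros, all of them of order `k`. -/
def InStratum (O : Origami S) (k n : ℕ) : Prop :=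
  {P : O.Surface | ¬ O.HasOrder P 0}.Finite ∧
  {P : O.Surface | ¬ O.HasOrder P 0}.ncard = n ∧
  ∀ P : O.Surface, ¬ O.HasOrder P 0 → O.HasOrder P k

/-- The origami is regular: its cover of the unit torus is normal, that is, deck transformations
act transitively on the fibres. -/
def IsRegular (O : Origami S) : Prop :=
  ∀ P Q : O.Surface, O.proj P = O.proj Q →
    ∃ f : O.Surface ≃ₜ O.Surface, (∀ R, O.proj (f R) = O.proj R) ∧ f P = Q

/-- The translation group of the origami: the automorphisms `f` of the surface with `f^* ω = ω`.
As `ω` is the pull-back of `dz` under `proj`, these are the self-homeomorphisms `f` for which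
`proj ∘ f - proj` is locally constant, that is, which are translations in the flat coordinates. -/
def trans (O : Origami S) : Subgroup (O.Surface ≃ₜ O.Surface) where
  carrier := {f | IsLocallyConstant fun P => O.proj (f P) - O.proj P}
  one_mem' := by
    have : (fun P => O.proj ((1 : O.Surface ≃ₜ O.Surface) P) - O.proj P) = fun _ => 0 := by
      funext P
      exact sub_self _
    rw [Set.mem_ofPred_eq, this]
    exact IsLocallyConstant.const 0
  mul_mem' := by
    intro f g hf hg
    have : (fun P => O.proj ((f * g) P) - O.proj P) =
        ((fun P => O.proj (f P) - O.proj P) ∘ g) + fun P => O.proj (g P) - O.proj P := by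
      funext P
      exact (sub_add_sub_cancel _ _ _).symm
    rw [Set.mem_ofPred_eq, this]
    exact (hf.comp_continuous g.continuous).add hg
  inv_mem' := by
    intro f hf
    have : (fun P => O.proj (f⁻¹ P) - O.proj P) =
        -((fun P => O.proj (f P) - O.proj P) ∘ (f⁻¹ : O.Surface ≃ₜ O.Surface)) := by
      funext P
      have h : f (f⁻¹ P) = P := f.apply_symm_apply P
      simp only [Pi.neg_apply, Function.comp_apply, h, neg_sub]
    rw [Set.mem_ofPred_eq, this]
    exact (hf.comp_continuous (f⁻¹ : O.Surface ≃ₜ O.Surface).continuous).neg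

end Origami

/-- `G` is isomorphic to a semidirect product `(ℤ/l × ℤ/2 × ℤ/2) ⋊ ℤ/3`. -/
def IsKleinType (l : ℕ) (G : Type u) [Group G] : Prop :=
  ∃ φ : Multiplicative (ZMod 3) →*
      MulAut (Multiplicative (ZMod l) × Multiplicative (ZMod 2) × Multiplicative (ZMod 2)),
    Nonempty (G ≃* (Multiplicative (ZMod l) × Multiplicative (ZMod 2) × Multiplicative (ZMod 2))
      ⋊[φ] Multiplicative (ZMod 3))

/-- `G` is isomorphic to a semidirect product `(ℤ/l × Q₈) ⋊ ℤ/3`. -/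
def IsQuaternionType (l : ℕ) (G : Type u) [Group G] : Prop :=
  ∃ φ : Multiplicative (ZMod 3) →* MulAut (Multiplicative (ZMod l) × QuaternionGroup 2),
    Nonempty (G ≃* (Multiplicative (ZMod l) × QuaternionGroup 2) ⋊[φ] Multiplicative (ZMod 3))

/-- The group `G` is generated by `x` and `y`, has order `2 (k + 1) q`, and the commutator
`x y x⁻¹ y⁻¹` has order `k + 1`. -/
def IsAdmissible (k q : ℕ) (G : Type u) [Group G] (x y : G) : Prop :=
  Nat.card G = 2 * (k + 1) * q ∧ Subgroup.closure {x, y} = ⊤ ∧ orderOf (x * y * x⁻¹ * y⁻¹) = k + 1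

/-- The numerical condition on `k` and `q`. -/
def ArithCondition (k q : ℕ) : Prop :=
  q = 3 ∧
    ((k % 4 = 1 ∧ ∀ p : ℕ, p.Prime → p ∣ (k + 1) / 2 → p % 3 = 1) ∨
      (k % 4 = 3 ∧ ∀ p : ℕ, p.Prime → p ∣ (k + 1) / 4 → p % 3 = 1))

/-! ### Signs of permutations and perfect groups -/

/-! A deck transformation is determined by the image of one square. Hence the squares of a regular
origami can be labelled by a group G with generators x, y so that the gluings are right
multiplications by x and y (`exists_cayley_of_isRegular`). The squares around a vertex form an orbit
of right multiplication by a conjugate of [x,y] (`ncard_vertex_of_cayley`), so H(k^{2q}) means that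
[x,y] has order k+1 and |G| = 2(k+1)q. As k ≥ 1, the vertices are genuine singularities,
translations are deck transformations, and the translation group is G. What remains is group theory.

Let c = [x,y] and H = ⟨c⟩, of index 2q. The index of G' divides 2q. The sign of the regular
representation of G' shows that |G' : H| is even whenever G/G' is cyclic, which excludes the indices
2 and 2q; a perfect G is excluded by counting the fixed points and cycles of c on G/H
(`false_of_perfect_of_core_free`). So |G : G'| = q and |G' : H| = 2.

Then ⟨c²⟩ is normal in G, and an element t outside G' moves the involutions of the four-group
G'/⟨c²⟩, which forces q = 3 (`exists_conj_of_card_commutator`). Being cyclic and normal, ⟨c²⟩ is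
centralized by G'. The relations between the 2-part of c and its conjugates under t leave only the
four-group or Q₈ as the 2-part of G'. On the odd part, of order λ, t acts as a power map r with r³ ≡
1 and r - 1 invertible mod λ, so every prime factor of λ is 1 mod 3 (`exists_quaternion_data`).
Schur–Zassenhaus splits off ℤ/3.

Conversely, a root r of X² + X + 1 mod λ and an automorphism of order three of the four-group or of
Q₈ give an automorphism of the product. The semidirect product with the group that it generates is
the required G (`exists_isAdmissible_of_mulAut`). -/

theorem Equiv.Perm.sign_eq_of_free {X : Type*} [Fintype X] [DecidableEq X] (σ : Equiv.Perm X)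
    {n : ℕ} (hn : Even n) (hσ : σ ^ n = 1)
    (hfree : ∀ x, σ x ≠ x → ∀ j : ℕ, (σ ^ j) x = x → n ∣ j) :
    n ∣ σ.support.card ∧ Equiv.Perm.sign σ = (-1) ^ (σ.support.card / n) := by
  -- Cycle lengths divide n because σ ^ n = 1, and n divides them by freeness.
  have hall : ∀ l ∈ σ.cycleType, l = n := by
    intro l hl
    apply Nat.dvd_antisymm
    · exact (Equiv.Perm.dvd_of_mem_cycleType hl).trans (orderOf_dvd_of_pow_eq_one hσ)
    · rw [Equiv.Perm.mem_cycleType_iff] at hl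
      obtain ⟨c, τ, rfl, hd, hc, rfl⟩ := hl
      obtain ⟨x, hx⟩ := hc.nonempty_support
      have hx' : c x ≠ x := Equiv.Perm.mem_support.1 hx
      have hτ : τ x = x := (hd x).resolve_left hx'
      apply hfree x
      · rw [Equiv.Perm.mul_apply, hτ]
        exact hx'
      · rw [hd.commute.mul_pow, ← hc.orderOf, pow_orderOf_eq_one, one_mul]
        exact Equiv.Perm.pow_apply_eq_self_of_apply_eq_self hτ _
  have hrep := Multiset.eq_replicate_card.2 hall
  have hsum : σ.cycleType.card * n = σ.support.card := by
    rw [← Equiv.Perm.sum_cycleType, hrep]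
    simp
  refine ⟨⟨_, by rw [mul_comm]; exact hsum.symm⟩, ?_⟩
  rcases Nat.eq_zero_or_pos n with rfl | hpos
  · have h0 : σ.cycleType.card = 0 := by
      by_contra h
      obtain ⟨l, hl⟩ := Multiset.card_pos_iff_exists_mem.1 (Nat.pos_of_ne_zero h)
      have := Equiv.Perm.two_le_of_mem_cycleType hl
      have := hall l hl
      omega
    rw [Equiv.Perm.sign_of_cycleType, Equiv.Perm.sum_cycleType, ← hsum, h0]
  · rw [Equiv.Perm.sign_of_cycleType, Equiv.Perm.sum_cycleType, ← hsum,
      Nat.mul_div_cancel _ hpos, pow_add, pow_mul', hn.neg_one_pow, one_pow, one_mul]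

open Classical in
/-- The sign of the left regular representation. -/
noncomputable def regularSign (G : Type*) [Group G] [Fintype G] : G →* ℤˣ :=
  Equiv.Perm.sign.comp (MulAction.toPermHom G G)

/-- Left translation by c moves every element, in cycles of length exactly the order of c. -/
theorem regularSign_of_even_order {G : Type*} [Group G] [Fintype G] (c : G)
    (hc : Even (orderOf c)) :
    regularSign G c = (-1) ^ (Nat.card G / orderOf c) := by
  classical
  have hpow : ∀ (j : ℕ) (x : G), ((MulAction.toPermHom G G c) ^ j) x = c ^ j * x := by
    intro j x
    rw [← map_pow]
    rfl
  have h := Equiv.Perm.sign_eq_of_free (MulAction.toPermHom G G c) hc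
    (by rw [← map_pow, pow_orderOf_eq_one, map_one])
    (by
      intro x _ j hj
      rw [hpow] at hj
      exact orderOf_dvd_of_pow_eq_one (mul_eq_right.1 hj))
  have hne : c ≠ 1 := by
    rintro rfl
    simp at hc
  have hsupp : (MulAction.toPermHom G G c).support = Finset.univ := by
    ext x
    simp [hne]
  rw [hsupp, Finset.card_univ, ← Nat.card_eq_fintype_card] at h
  have h2 := h.2
  unfold regularSign
  rw [MonoidHom.comp_apply]
  convert h2

theorem regularSign_mulEquiv {G : Type*} [Group G] [Fintype G] (e : G ≃* G) (g : G) :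
    regularSign G (e g) = regularSign G g := by
  classical
  have : MulAction.toPermHom G G (e g) = (e.toEquiv.symm.trans (MulAction.toPermHom G G g)).trans
      e.toEquiv := by
    ext x
    simp [MulAction.toPermHom]
  unfold regularSign
  rw [MonoidHom.comp_apply, MonoidHom.comp_apply, this]
  exact Equiv.Perm.sign_symm_trans_trans _ _

theorem MonoidHom.eq_one_of_commutator_eq_top {G A : Type*} [Group G] [CommGroup A]
    (hG : commutator G = ⊤) (f : G →* A) (g : G) : f g = 1 := by
  have : g ∈ commutator G := hG ▸ Subgroup.mem_top g
  exact Abelianization.commutator_subset_ker f this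

/-- An involution acts in the regular representation as m transpositions, an odd permutation, so the
sign is a nontrivial homomorphism to an abelian group. -/
theorem commutator_ne_top_of_card_eq_two_mul_odd {G : Type*} [Group G] [Finite G]
    {m : ℕ} (hm : Odd m) (hG : Nat.card G = 2 * m) : commutator G ≠ ⊤ := by
  intro htop
  have := Fintype.ofFinite G
  have : Fact (Nat.Prime 2) := ⟨Nat.prime_two⟩
  obtain ⟨g, hg⟩ := exists_prime_orderOf_dvd_card' (G := G) 2 (hG ▸ dvd_mul_right 2 m)
  have h1 := regularSign_of_even_order g (by rw [hg]; exact even_two)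
  rw [MonoidHom.eq_one_of_commutator_eq_top htop, hg, hG, Nat.mul_div_cancel_left _ two_pos,
    hm.neg_one_pow] at h1
  exact absurd h1 (by decide)

/-- The hypotheses make G'/N central in G/N with cyclic quotient, so G/N is abelian. -/
theorem commutator_le_of_isCyclic_quotient {G : Type*} [Group G] (N : Subgroup G) [N.Normal]
    [IsCyclic (G ⧸ commutator G)]
    (hN : N ≤ commutator G) (h : ∀ g : G, ∀ d ∈ commutator G, g * d * g⁻¹ * d⁻¹ ∈ N) :
    commutator G ≤ N := by
  let f : G ⧸ N →* G ⧸ commutator G := QuotientGroup.map N (commutator G) (MonoidHom.id G) hN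
  have hf : f.ker ≤ Subgroup.center (G ⧸ N) := by
    intro z hz
    obtain ⟨d, rfl⟩ := QuotientGroup.mk_surjective z
    have hd : d ∈ commutator G := (QuotientGroup.eq_one_iff d).1 hz
    rw [Subgroup.mem_center_iff]
    intro z'
    obtain ⟨g, rfl⟩ := QuotientGroup.mk_surjective z'
    have := (QuotientGroup.eq_one_iff (N := N) _).2 (h g d hd)
    rw [QuotientGroup.mk_mul, QuotientGroup.mk_mul, QuotientGroup.mk_mul, QuotientGroup.mk_inv,
      QuotientGroup.mk_inv, mul_inv_eq_one, mul_inv_eq_iff_eq_mul] at this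
    exact this
  have hcomm := MonoidHom.isMulCommutative_of_isCyclic_of_ker_le_center f hf
  rw [commutator_def, Subgroup.commutator_le]
  intro a _ b _
  rw [← QuotientGroup.eq_one_iff]
  rw [commutatorElement_def, QuotientGroup.mk_mul, QuotientGroup.mk_mul, QuotientGroup.mk_mul,
    QuotientGroup.mk_inv, QuotientGroup.mk_inv, hcomm.is_comm.comm (a : G ⧸ N) b, mul_inv_cancel_right, mul_inv_cancel]

/-- The regular sign of G' is invariant under conjugation by G, so its kernel is normal in G and
contains [G, G']; as G/G' is cyclic, the kernel is all of G'. An odd quotient would give c the sign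
-1. -/
theorem even_card_commutator_div_orderOf {G : Type*} [Group G] [Finite G]
    [IsCyclic (G ⧸ commutator G)] {c : G} (hc : c ∈ commutator G) (hc2 : Even (orderOf c)) :
    Even (Nat.card (commutator G) / orderOf c) := by
  have := Fintype.ofFinite (commutator G)
  rw [← Nat.not_odd_iff_even]
  intro hodd
  have hsign : regularSign (commutator G) ⟨c, hc⟩ = -1 := by
    rw [regularSign_of_even_order _ (by rwa [Subgroup.orderOf_mk]), Subgroup.orderOf_mk,
      hodd.neg_one_pow]
  let N : Subgroup G := (regularSign (commutator G)).ker.map (commutator G).subtype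
  have hN : N.Normal := by
    constructor
    rintro _ ⟨d, hd, rfl⟩ g
    refine ⟨MulAut.conjNormal g d, ?_, MulAut.conjNormal_apply g d⟩
    have hd' : regularSign (commutator G) d = 1 := hd
    exact (regularSign_mulEquiv _ d).trans hd'
  have hle : commutator G ≤ N := by
    refine commutator_le_of_isCyclic_quotient N ?_ ?_
    · exact Subgroup.map_subtype_le _
    · intro g d hd
      refine ⟨MulAut.conjNormal g ⟨d, hd⟩ * ⟨d, hd⟩⁻¹, ?_, ?_⟩
      · change regularSign (commutator G) (MulAut.conjNormal g ⟨d, hd⟩ * ⟨d, hd⟩⁻¹) = 1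
        rw [map_mul, map_inv, regularSign_mulEquiv, mul_inv_cancel]
      · rw [map_mul, map_inv]
        simp
  obtain ⟨d, hd, hdc⟩ := hle hc
  have hd' : regularSign (commutator G) d = 1 := hd
  rw [show d = ⟨c, hc⟩ from Subtype.ext hdc, hsign] at hd'
  exact absurd hd' (by decide)

/-! ### Perfect groups have no cyclic subgroup of index twice an odd prime -/

section Perfect

open Subgroup

theorem Nat.dvd_two_mul_prime {q d : ℕ} (hq : q.Prime) (h : d ∣ 2 * q) :
    d = 1 ∨ d = 2 ∨ d = q ∨ d = 2 * q := by
  obtain ⟨a, b, ha, hb, rfl⟩ := Nat.dvd_mul.1 h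
  rcases (Nat.dvd_prime Nat.prime_two).1 ha with rfl | rfl <;>
    rcases (Nat.dvd_prime hq).1 hb with rfl | rfl <;> simp

/-- The automorphism group of a cyclic group is abelian, so commutators act trivially on N. -/
theorem commute_of_mem_commutator_of_isCyclic {G : Type*} [Group G] (N : Subgroup G) [N.Normal]
    [IsCyclic N] {d n : G} (hd : d ∈ commutator G) (hn : n ∈ N) : Commute d n := by
  let f : G →* (ZMod (Nat.card N))ˣ :=
    (IsCyclic.mulAutMulEquiv N).toMonoidHom.comp MulAut.conjNormal
  have hf : IsCyclic.mulAutMulEquiv N (MulAut.conjNormal d) = 1 :=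
    Abelianization.commutator_subset_ker f hd
  have h1 : (MulAut.conjNormal d : MulAut N) = 1 := by
    rwa [map_eq_one_iff _ (MulEquiv.injective _)] at hf
  have h2 : d * n * d⁻¹ = n := by
    rw [← MulAut.conjNormal_apply d ⟨n, hn⟩, h1]
    rfl
  exact mul_inv_eq_iff_eq_mul.1 h2

variable {G : Type*} [Group G] [Finite G]

/-- Quotients of perfect groups are perfect, but a nontrivial group with cyclic Sylow subgroups is
not. It is applied to quotients of squarefree order. -/
theorem eq_top_of_isZGroup_quotient (hG : commutator G = ⊤) (K : Subgroup G) [K.Normal]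
    [IsZGroup (G ⧸ K)] : K = ⊤ := by
  have hs : commutator (G ⧸ K) = ⊤ := by
    have h := Subgroup.map_commutator (⊤ : Subgroup G) ⊤ (QuotientGroup.mk' K)
    rw [← _root_.commutator_def, hG, Subgroup.map_top_of_surjective _
      (QuotientGroup.mk'_surjective K)] at h
    exact h.symm
  by_contra hK
  have : Nontrivial (G ⧸ K) := QuotientGroup.nontrivial_iff.2 hK
  exact (IsZGroup.commutator_lt (G ⧸ K)).ne hs

theorem not_normal_of_prime_index (hG : commutator G = ⊤) {p : ℕ} (hp : p.Prime) (L : Subgroup G)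
    (hL : L.index = p) : ¬ L.Normal := by
  intro hn
  have : IsZGroup (G ⧸ L) := IsZGroup.of_squarefree (by
    rw [← Subgroup.index_eq_card, hL]
    exact hp.prime.squarefree)
  have := eq_top_of_isZGroup_quotient hG L
  rw [← Subgroup.index_eq_one, hL] at this
  exact hp.one_lt.ne' this

theorem index_ne_two_of_perfect (hG : commutator G = ⊤) (L : Subgroup G) : L.index ≠ 2 :=
  fun h => not_normal_of_prime_index hG Nat.prime_two L h (Subgroup.normal_of_index_eq_two h)

/-- The action on three cosets has its image in S₃, whose order is squarefree. -/
theorem index_ne_three_of_perfect (hG : commutator G = ⊤) (L : Subgroup G) : L.index ≠ 3 := by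
  intro h
  let f := MulAction.toPermHom G (G ⧸ L)
  have hcard : Nat.card (G ⧸ f.ker) ∣ 6 := by
    rw [Nat.card_congr (QuotientGroup.quotientKerEquivRange f).toEquiv]
    refine (Subgroup.card_subgroup_dvd_card f.range).trans ?_
    rw [Nat.card_perm, ← Subgroup.index_eq_card, h]
    decide
  have h6 : Squarefree 6 := by
    rw [show 6 = 2 * 3 by rfl, Nat.squarefree_mul (by decide)]
    exact ⟨Nat.prime_two.prime.squarefree, Nat.prime_three.prime.squarefree⟩
  have : IsZGroup (G ⧸ f.ker) := IsZGroup.of_squarefree (h6.squarefree_of_dvd hcard)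
  have htop := eq_top_of_isZGroup_quotient hG f.ker
  rw [← Subgroup.normalCore_eq_ker] at htop
  have : L = ⊤ := top_le_iff.1 (htop ▸ L.normalCore_le)
  rw [← Subgroup.index_eq_one, h] at this
  omega

/-- A subgroup of prime index is maximal, and here it is not normal. -/
theorem normalizer_eq_self_of_prime_index (hG : commutator G = ⊤) {p : ℕ} (hp : p.Prime)
    (L : Subgroup G) (hL : L.index = p) : normalizer (L : Set G) = L := by
  have h := Subgroup.relIndex_mul_index (le_normalizer (H := L))
  rw [hL] at h
  have h1 : (normalizer (L : Set G)).index ≠ 1 := by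
    rw [Ne, Subgroup.index_eq_one, normalizer_eq_top_iff]
    exact not_normal_of_prime_index hG hp L hL
  have h2 := ((Nat.dvd_prime hp).1 ⟨_, by rw [mul_comm]; exact h.symm⟩).resolve_left h1
  rw [h2] at h
  have h3 : L.relIndex (normalizer (L : Set G)) = 1 := by
    have := hp.pos
    exact Nat.eq_of_mul_eq_mul_right this (by rw [h, one_mul])
  exact le_antisymm (Subgroup.relIndex_eq_one.1 h3) le_normalizer

/-- In a perfect group, a cyclic core-free subgroup of index `2q` meets its conjugates by elements
outside its normalizer trivially. -/
theorem eq_one_of_mem_conj_of_perfect (hG : commutator G = ⊤) {q : ℕ} (hq : q.Prime)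
    (H : Subgroup G) [IsCyclic H] (hcore : H.normalCore = ⊥)
    (hidx : H.index = 2 * q) (hL1 : (normalizer (H : Set G)).index ≠ 1)
    {g : G} (hg : g ∉ normalizer (H : Set G)) {a : G} (ha : a ∈ H) (hga : g⁻¹ * a * g ∈ H) :
    a = 1 := by
  set L := normalizer (H : Set G) with hLdef
  set K : Subgroup G := H.map (MulAut.conj g).toMonoidHom with hKdef
  have hKmem : ∀ x, x ∈ K ↔ g⁻¹ * x * g ∈ H := by
    intro x
    constructor
    · rintro ⟨h, hh, rfl⟩
      simpa [mul_assoc] using hh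
    · intro hx
      exact ⟨_, hx, by simp [mul_assoc]⟩
  have hKcard : Nat.card K = Nat.card H := card_map_of_injective (MulEquiv.injective _)
  set J := H ⊔ K with hJdef
  have hHJ : H ≤ J := le_sup_left
  have hKJ : K ≤ J := le_sup_right
  have hJ := Subgroup.relIndex_mul_index hHJ
  have hKidx : K.index = 2 * q := by
    have h1 := K.card_mul_index
    rw [← H.card_mul_index, hKcard, hidx] at h1
    exact Nat.eq_of_mul_eq_mul_left Nat.card_pos h1
  have hJK := Subgroup.relIndex_mul_index hKJ
  rw [hidx] at hJ
  rw [hKidx] at hJK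
  rcases Nat.dvd_two_mul_prime hq (d := J.index) (Dvd.intro_left _ hJ) with
    h | h | h | h
  -- J = G: the abelian groups H and K both contain a, so a is central and ⟨a⟩ lies in the trivial
  -- core of H.
  · rw [Subgroup.index_eq_one] at h
    have hJcent : J ≤ Subgroup.centralizer {a} := by
      refine sup_le ?_ ?_
      · intro b hb
        rw [Subgroup.mem_centralizer_singleton_iff]
        have := (IsCyclic.commGroup (α := H)).mul_comm ⟨b, hb⟩ ⟨a, ha⟩
        exact congrArg Subtype.val this
      · intro b hb
        rw [Subgroup.mem_centralizer_singleton_iff]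
        have := (IsCyclic.commGroup (α := H)).mul_comm ⟨_, (hKmem b).1 hb⟩ ⟨_, hga⟩
        have h2 : g⁻¹ * b * g * (g⁻¹ * a * g) = g⁻¹ * a * g * (g⁻¹ * b * g) :=
          congrArg Subtype.val this
        have h3 : g⁻¹ * (b * a) * g = g⁻¹ * (a * b) * g := by
          simpa [mul_assoc] using h2
        exact mul_left_cancel (mul_right_cancel h3)
    have hcen : ∀ b : G, b * a = a * b := by
      intro b
      have : b ∈ J := h ▸ Subgroup.mem_top b
      exact Subgroup.mem_centralizer_singleton_iff.1 (hJcent this)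
    have hnorm : (zpowers a).Normal := by
      constructor
      rintro _ ⟨i, rfl⟩ b
      refine ⟨i, ?_⟩
      have : Commute b (a ^ i) := Commute.zpow_right (hcen b) i
      simp only
      rw [this.eq, mul_inv_cancel_right]
    have hle : zpowers a ≤ H.normalCore := Subgroup.normal_le_normalCore.2 (by simpa using ha)
    rw [hcore, le_bot_iff, Subgroup.zpowers_eq_bot] at hle
    exact hle
  · exact absurd h (index_ne_two_of_perfect hG J)
  -- J has index q: H and K have index two in J, so J normalizes both and J = L. Then L normalizes
  -- gHg⁻¹, hence g⁻¹ normalizes L, which is its own normalizer.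
  · exfalso
    rw [h] at hJ hJK
    have hrel : H.relIndex J = 2 := Nat.eq_of_mul_eq_mul_right hq.pos hJ
    have hrelK : K.relIndex J = 2 := Nat.eq_of_mul_eq_mul_right hq.pos hJK
    have hJL : J ≤ L := (normal_subgroupOf_iff_le_normalizer hHJ).1
      (Subgroup.normal_of_index_eq_two hrel)
    have hJLK : J ≤ normalizer (K : Set G) := (normal_subgroupOf_iff_le_normalizer hKJ).1
      (Subgroup.normal_of_index_eq_two hrelK)
    have hLidx : L.index = q :=
      ((Nat.dvd_prime hq).1 (h ▸ Subgroup.index_dvd_of_le hJL)).resolve_left hL1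
    have hcardJL : Nat.card J = Nat.card L := by
      have h1 := J.card_mul_index
      rw [← L.card_mul_index, h, hLidx] at h1
      exact Nat.eq_of_mul_eq_mul_right hq.pos h1
    have hJeq : J = L := Subgroup.eq_of_le_of_card_ge hJL hcardJL.ge
    have hgL : g⁻¹ ∈ normalizer (L : Set G) := by
      apply mem_normalizer_fintype
      intro j hj
      have hj' : j ∈ normalizer (K : Set G) := hJLK (hJeq ▸ hj)
      rw [mem_normalizer_iff] at hj'
      change g⁻¹ * j * g⁻¹⁻¹ ∈ L
      rw [hLdef, mem_normalizer_iff]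
      intro x
      have h1 := hj' (g * x * g⁻¹)
      rw [hKmem, hKmem] at h1
      simpa [mul_assoc] using h1
    rw [normalizer_eq_self_of_prime_index hG hq L hLidx, inv_mem_iff] at hgL
    exact hg hgL
  -- J has index 2q: then J = H contains K, so g normalizes H.
  · exfalso
    rw [h] at hJ
    have hrel : H.relIndex J = 1 :=
      Nat.eq_of_mul_eq_mul_right (m := 2 * q) (by have := hq.pos; omega) (by rw [hJ, one_mul])
    have hKH : K ≤ H := hKJ.trans (Subgroup.relIndex_eq_one.1 hrel)
    apply hg
    apply mem_normalizer_fintype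
    intro x hx
    exact hKH ((hKmem _).2 (by simpa [mul_assoc] using hx))

/-- With L the normalizer of H and n = |H|, a generator c of H fixes the cosets in L/H and permutes
all others in cycles of length n. Counting cosets and signs gives |L| = 2n and n ∣ q - 1, and
Sylow's theorem for the prime q then leaves two cases, both impossible in a perfect group. -/
theorem false_of_perfect_of_core_free (hG : commutator G = ⊤) {q : ℕ} (hq : q.Prime) (hq2 : q ≠ 2)
    (H : Subgroup G) [IsCyclic H] (hcore : H.normalCore = ⊥) (hidx : H.index = 2 * q) : False := by
  have hcardG := H.card_mul_index
  rw [hidx] at hcardG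
  set n := Nat.card H with hn
  have hqodd : Odd q := hq.odd_of_ne_two hq2
  have hneven : Even n := by
    by_contra hodd
    rw [Nat.not_even_iff_odd] at hodd
    exact commutator_ne_top_of_card_eq_two_mul_odd (hodd.mul hqodd) (by rw [← hcardG]; ring) hG
  have hnpos : 0 < n := Nat.card_pos
  have hn2 : 2 ≤ n := by
    obtain ⟨r, hr⟩ := hneven
    omega
  set L := normalizer (H : Set G) with hL
  have hL1 : L.index ≠ 1 := by
    intro h
    rw [Subgroup.index_eq_one, normalizer_eq_top_iff] at h
    rw [Subgroup.normalCore_eq_self] at hcore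
    rw [hcore, Subgroup.card_bot] at hn
    omega
  obtain ⟨⟨c, hcH⟩, hcgen⟩ := IsCyclic.exists_generator (α := H)
  have hord : orderOf c = n := by
    rw [hn, ← orderOf_eq_card_of_forall_mem_zpowers hcgen, Subgroup.orderOf_mk]
  have hc1 : c ≠ 1 := by
    rintro rfl
    rw [orderOf_one] at hord
    omega
  have htriv := fun g (hg : g ∉ L) a =>
    eq_one_of_mem_conj_of_perfect hG hq H hcore hidx hL1 (g := g) hg (a := a)
  classical
  have := Fintype.ofFinite (G ⧸ H)
  let σ := MulAction.toPermHom G (G ⧸ H) c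
  have hσ : ∀ (j : ℕ) (g : G), (σ ^ j) (g : G ⧸ H) = (g : G ⧸ H) ↔ g⁻¹ * c ^ j * g ∈ H := by
    intro j g
    have h1 : (σ ^ j) (g : G ⧸ H) = ((c ^ j * g : G) : G ⧸ H) := by
      simp only [σ]
      rw [← map_pow]
      rfl
    rw [h1, eq_comm, QuotientGroup.eq, mul_assoc]
  have hfix : ∀ g : G, σ (g : G ⧸ H) = (g : G ⧸ H) ↔ g ∈ L := by
    intro g
    have h1 := hσ 1 g
    rw [pow_one, pow_one] at h1
    rw [h1]
    constructor
    · intro h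
      by_contra hg
      exact hc1 (htriv g hg c hcH h)
    · intro h
      have h2 := (mem_normalizer_iff.1 (inv_mem h) c).1 hcH
      rwa [inv_inv] at h2
  have hsign := Equiv.Perm.sign_eq_of_free σ hneven
    (by
      rw [← map_pow, ← hord, pow_orderOf_eq_one, map_one])
    (by
      intro x hx j hj
      obtain ⟨g, rfl⟩ := QuotientGroup.mk_surjective x
      have hg : g ∉ L := fun h => hx ((hfix g).2 h)
      rw [← hord]
      exact orderOf_dvd_of_pow_eq_one (htriv g hg _ (pow_mem hcH j) ((hσ j g).1 hj)))
  have hs1 : Equiv.Perm.sign σ = 1 := MonoidHom.eq_one_of_commutator_eq_top hG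
    (Equiv.Perm.sign.comp (MulAction.toPermHom G (G ⧸ H))) c
  have hF : Nat.card L = n * Nat.card {x : G ⧸ H | σ x = x} := by
    rw [hn, ← Nat.card_prod]
    rw [← Nat.card_congr (QuotientGroup.preimageMkEquivSubgroupProdSet H {x : G ⧸ H | σ x = x})]
    refine Nat.card_congr (Equiv.subtypeEquivRight fun g => ?_)
    exact (hfix g).symm
  have hsupp : σ.support.card + Nat.card {x : G ⧸ H | σ x = x} = 2 * q := by
    have h1 : Nat.card {x : G ⧸ H | σ x = x} = (Finset.univ.filter fun x => σ x = x).card := by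
      rw [Nat.card_eq_fintype_card, Fintype.card_subtype]
      rfl
    have h2 : σ.support = Finset.univ.filter fun x => ¬ σ x = x := by
      ext x
      simp
    rw [h1, h2, add_comm, Finset.card_filter_add_card_filter_not, Finset.card_univ, ← hidx,
      Subgroup.index_eq_card, Nat.card_eq_fintype_card]
  have hLidx : L.index = q := by
    have h1 : L.index ∣ 2 * q := hidx ▸ Subgroup.index_dvd_of_le le_normalizer
    rcases Nat.dvd_two_mul_prime hq h1 with h | h | h | h
    · exact absurd h hL1
    · exact absurd h (index_ne_two_of_perfect hG L)
    · exact h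
    -- Here L = H, so c fixes one coset and moves 2q - 1, an odd number that the even n would
    -- divide.
    · exfalso
      have h2 := L.card_mul_index
      rw [← hcardG, h] at h2
      have h3 : Nat.card L = n := Nat.eq_of_mul_eq_mul_right (by have := hq.pos; omega) h2
      rw [h3] at hF
      have h4 : Nat.card {x : G ⧸ H | σ x = x} = 1 :=
        Nat.eq_of_mul_eq_mul_left hnpos (by rw [← hF, mul_one])
      have h5 : Even σ.support.card := hneven.trans_dvd hsign.1
      obtain ⟨r, hr⟩ := h5
      omega
  have hLcard : Nat.card L = 2 * n := by
    have h2 := L.card_mul_index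
    rw [← hcardG, hLidx] at h2
    exact Nat.eq_of_mul_eq_mul_right hq.pos (by rw [h2]; ring)
  -- Two cosets are fixed and the other 2q - 2 form r cycles of length n. The permutation is even,
  -- so r = 2s and n * s = q - 1.
  have hndvd : n ∣ q - 1 := by
    have h4 : Nat.card {x : G ⧸ H | σ x = x} = 2 :=
      Nat.eq_of_mul_eq_mul_left hnpos (by rw [← hF, hLcard]; ring)
    obtain ⟨⟨r, hr⟩, hs⟩ := hsign
    rw [hs1, hr, Nat.mul_div_cancel_left _ hnpos] at hs
    have hev : Even r := by
      by_contra hodd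
      rw [Nat.not_even_iff_odd] at hodd
      rw [hodd.neg_one_pow] at hs
      exact absurd hs (by decide)
    obtain ⟨s, rfl⟩ := hev
    refine ⟨s, ?_⟩
    have : n * (s + s) = 2 * (n * s) := by ring
    omega
  have hnle : n ≤ q - 1 := Nat.le_of_dvd (by have := hq.two_le; omega) hndvd
  have hqn : ¬ q ∣ 2 * n := by
    intro h
    rcases hq.dvd_mul.1 h with h | h
    · exact hq2 ((Nat.prime_dvd_prime_iff_eq hq Nat.prime_two).1 h)
    · have := Nat.le_of_dvd hnpos h
      omega
  have : Fact q.Prime := ⟨hq⟩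
  obtain ⟨P⟩ : Nonempty (Sylow q G) := inferInstance
  have hPidx : P.index ∣ 2 * n := by
    have h1 : P.index ∣ 2 * n * q := by
      rw [show 2 * n * q = Nat.card G by rw [← hcardG]; ring]
      exact Subgroup.index_dvd_card _
    exact Nat.Coprime.dvd_of_dvd_mul_right
      ((Nat.coprime_comm.1 ((Nat.Prime.coprime_iff_not_dvd hq).2 P.not_dvd_index))) h1
  have hdvd := P.card_dvd_index.trans hPidx
  have hmod := card_sylow_modEq_one q G
  have hle := Nat.le_of_dvd (by omega) hdvd
  -- The number of Sylow q-subgroups is 1 mod q and at most 2n ≤ 2(q - 1).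
  have hcases : Nat.card (Sylow q G) = 1 ∨ Nat.card (Sylow q G) = q + 1 := by
    have hpos : 0 < Nat.card (Sylow q G) := Nat.card_pos
    obtain ⟨r, hr⟩ := (Nat.modEq_iff_dvd' hpos).1 hmod.symm
    have hr2 : r < 2 := by
      by_contra h
      have : q * 2 ≤ q * r := Nat.mul_le_mul_left q (by omega)
      omega
    interval_cases r <;> omega
  rcases hcases with h | h
  -- A normal Sylow q-subgroup has order q, so it is central in the perfect group G. It then lies in
  -- the normalizer of L, which is L, of order 2n prime to q.
  · have hsub : Subsingleton (Sylow q G) := (Nat.card_eq_one_iff_unique.1 h).1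
    have hPn : P.Normal := P.normal_of_subsingleton
    have hPcard : Nat.card P = q := by
      rw [P.card_eq_multiplicity, ← hcardG, show n * (2 * q) = 2 * n * q by ring,
        Nat.factorization_mul (by omega) hq.ne_zero, Finsupp.add_apply,
        Nat.factorization_eq_zero_of_not_dvd hqn, hq.factorization_self, zero_add, pow_one]
    have : IsCyclic P := isCyclic_of_prime_card hPcard
    have hPL : (P : Subgroup G) ≤ normalizer (L : Set G) := by
      intro a ha
      rw [mem_normalizer_iff]
      intro h
      have := commute_of_mem_commutator_of_isCyclic (P : Subgroup G) (d := h)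
        (hG ▸ Subgroup.mem_top h) ha
      rw [← this.eq, mul_inv_cancel_right]
    rw [normalizer_eq_self_of_prime_index hG hq L hLidx] at hPL
    have := Subgroup.card_dvd_of_le hPL
    rw [hLcard] at this
    exact hqn (hPcard ▸ this)
  -- Since q + 1 divides 2n ≤ 2(q - 1), it equals 2n. Then n divides q - 1 = 2n - 2, so n = 2 and q
  -- = 3, and L has index three.
  · rw [h] at hdvd
    obtain ⟨s, hs⟩ := hdvd
    have hs1 : s = 1 := by
      have h0 : s ≠ 0 := by
        rintro rfl
        omega
      by_contra h1
      have : (q + 1) * 2 ≤ (q + 1) * s := Nat.mul_le_mul_left _ (by omega)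
      omega
    obtain ⟨r, hr⟩ := hndvd
    subst hs1
    have hr4 : r < 2 := by
      by_contra hlt
      have : n * 2 ≤ n * r := Nat.mul_le_mul_left _ (by omega)
      omega
    have hq3 : q = 3 := by
      interval_cases r <;> omega
    exact index_ne_three_of_perfect hG L (hLidx.trans hq3)

/-- Dividing by the core of H preserves perfection, cyclicity and the index, and makes the image of
H core-free. -/
theorem commutator_ne_top_of_isCyclic_of_index {q : ℕ} (hq : q.Prime) (hq2 : q ≠ 2)
    (H : Subgroup G) [IsCyclic H] (hidx : H.index = 2 * q) : commutator G ≠ ⊤ := by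
  intro hG
  let K := H.normalCore
  let f := QuotientGroup.mk' K
  have hf : Function.Surjective f := QuotientGroup.mk'_surjective K
  have hker : f.ker = K := QuotientGroup.ker_mk' K
  have hs : commutator (G ⧸ K) = ⊤ := by
    have h := Subgroup.map_commutator (⊤ : Subgroup G) ⊤ f
    rw [← _root_.commutator_def, hG, Subgroup.map_top_of_surjective _ hf] at h
    exact h.symm
  have : IsCyclic (H.map f) :=
    isCyclic_of_surjective (f.subgroupMap H) (f.subgroupMap_surjective H)
  refine false_of_perfect_of_core_free hs hq hq2 (H.map f) ?_ ?_
  · have hcomap : (H.map f).normalCore.comap f ≤ K := by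
      refine Subgroup.normal_le_normalCore.2 ?_
      refine (Subgroup.comap_mono (Subgroup.normalCore_le _)).trans ?_
      rw [Subgroup.comap_map_eq, hker]
      exact sup_le le_rfl H.normalCore_le
    rw [eq_bot_iff]
    intro z hz
    obtain ⟨g, rfl⟩ := hf z
    exact (QuotientGroup.eq_one_iff g).2 (hcomap hz)
  · rw [Subgroup.index_map_eq _ hf (hker.le.trans H.normalCore_le), hidx]

end Perfect

/-! ### Groups whose commutator subgroup has prime index and a cyclic subgroup of index two -/

section PrimeIndex

open Subgroup

/-- Either τ² or τ³ commutes with u, according to the image of v. So does τ^q; if the exponents were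
coprime, τ itself would commute with u. -/
theorem eq_three_of_conj_pow_prime {Q : Type*} [Group Q] {τ u v : Q} {q : ℕ} (hq : q.Prime)
    (hq2 : q ≠ 2) (hτu : τ * u * τ⁻¹ = v) (hτv : τ * v * τ⁻¹ = u ∨ τ * v * τ⁻¹ = u * v)
    (hvu : v ≠ u) (huv : u * v = v * u) (hvv : v * v = 1)
    (hτq : τ ^ q * u * (τ ^ q)⁻¹ = u) : q = 3 ∧ τ * v * τ⁻¹ = u * v := by
  have hcop : ∀ j : ℕ, Commute (τ ^ j) u → q.Coprime j → False := by
    intro j hj hcop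
    have h1 : Commute (τ ^ q) u := mul_inv_eq_iff_eq_mul.1 hτq
    have h2 : Commute τ u := by
      have h3 : τ = (τ ^ q) ^ (q.gcdA j) * (τ ^ j) ^ (q.gcdB j) := by
        rw [← zpow_natCast, ← zpow_natCast, ← zpow_mul, ← zpow_mul, ← zpow_add,
          ← Nat.gcd_eq_gcd_ab, hcop.gcd_eq_one, Nat.cast_one, zpow_one]
      rw [h3]
      exact (h1.zpow_left _).mul_left (hj.zpow_left _)
    rw [h2.eq, mul_inv_cancel_right] at hτu
    exact hvu hτu.symm
  have hτv' : τ * v * τ⁻¹ = u * v := by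
    refine hτv.resolve_left fun h => hcop 2 ?_ ?_
    · change τ ^ 2 * u = u * τ ^ 2
      rw [← mul_inv_eq_iff_eq_mul]
      calc τ ^ 2 * u * (τ ^ 2)⁻¹ = τ * (τ * u * τ⁻¹) * τ⁻¹ := by
            simp only [sq, mul_inv_rev, mul_assoc]
        _ = u := by rw [hτu, h]
    · exact (Nat.coprime_primes hq Nat.prime_two).2 hq2
  refine ⟨?_, hτv'⟩
  by_contra hq3
  refine hcop 3 ?_ ((Nat.coprime_primes hq Nat.prime_three).2 hq3)
  change τ ^ 3 * u = u * τ ^ 3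
  rw [← mul_inv_eq_iff_eq_mul]
  calc τ ^ 3 * u * (τ ^ 3)⁻¹ = τ * (τ * (τ * u * τ⁻¹) * τ⁻¹) * τ⁻¹ := by
        simp only [pow_succ, pow_zero, one_mul, mul_inv_rev, mul_assoc]
    _ = τ * (u * v) * τ⁻¹ := by rw [hτu, hτv']
    _ = (τ * u * τ⁻¹) * (τ * v * τ⁻¹) := by simp only [mul_assoc, inv_mul_cancel_left]
    _ = u := by rw [hτv', hτu, huv, ← mul_assoc, hvv, one_mul]

variable {G : Type*} [Group G]

theorem eq_top_of_prime_index {D M : Subgroup G} (hD : D.index.Prime) (hDM : D ≤ M) {t : G}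
    (ht : t ∉ D) (htM : t ∈ M) : M = ⊤ := by
  rcases (Nat.dvd_prime hD).1 (Subgroup.index_dvd_of_le hDM) with h | h
  · exact Subgroup.index_eq_one.1 h
  · exfalso
    have h1 := Subgroup.relIndex_mul_index hDM
    rw [h] at h1
    have h2 : D.relIndex M = 1 := Nat.eq_of_mul_eq_mul_right hD.pos (by rw [h1, one_mul])
    exact ht (Subgroup.relIndex_eq_one.1 h2 htM)

/-- If the commutator subgroup has odd prime index `q` and contains the cyclic group generated by
`c` with index two, then `q = 3`, the subgroup generated by `c ^ 2` is normal, and an element `t`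
outside of the commutator subgroup permutes the involutions of the four-group `G' / ⟨c ^ 2⟩`
cyclically. -/
theorem exists_conj_of_card_commutator [Finite G] (hprime : (commutator G).index.Prime)
    (hne2 : (commutator G).index ≠ 2) {c : G} (hc : c ∈ commutator G) (hev : Even (orderOf c))
    (hcard : Nat.card (commutator G) = 2 * orderOf c) :
    (commutator G).index = 3 ∧ (zpowers (c ^ 2)).Normal ∧ ∃ t : G, t ∉ commutator G ∧
      (∀ M : Subgroup G, c ∈ M → t * c * t⁻¹ ∈ M → commutator G ≤ M) ∧
      (t * c * t⁻¹) * c * (t * c * t⁻¹)⁻¹ * c⁻¹ ∈ zpowers (c ^ 2) ∧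
      (c * (t * c * t⁻¹))⁻¹ * (t * (t * c * t⁻¹) * t⁻¹) ∈ zpowers (c ^ 2) := by
  set D := commutator G with hD
  set H := zpowers c with hH
  set Z := zpowers (c ^ 2) with hZ
  have hpos : 0 < orderOf c := orderOf_pos c
  have hHD : H ≤ D := by simpa [hH] using hc
  have hcH : c ∈ H := mem_zpowers c
  have hrel : H.relIndex D = 2 := by
    have h1 := Subgroup.relIndex_mul_index hHD
    have h2 := H.card_mul_index
    rw [← D.card_mul_index, ← h1, hcard, hH, Nat.card_zpowers, mul_comm 2, mul_assoc] at h2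
    exact Nat.eq_of_mul_eq_mul_right hprime.pos (Nat.eq_of_mul_eq_mul_left hpos h2)
  have hnormD : D ≤ normalizer (H : Set G) := (normal_subgroupOf_iff_le_normalizer hHD).1
      (Subgroup.normal_of_index_eq_two hrel)
  have hmul : ∀ a ∈ D, ∀ b ∈ D, a ∉ H → b ∉ H → a * b ∈ H := by
    intro a ha b hb haH hbH
    have h1 := Subgroup.mul_mem_iff_of_index_two (H := H.subgroupOf D) hrel (a := ⟨a, ha⟩)
      (b := ⟨b, hb⟩)
    have h2 := h1.2 (by
      rw [mem_subgroupOf, mem_subgroupOf]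
      exact iff_of_false haH hbH)
    exact h2
  obtain ⟨t, ht⟩ : ∃ t, t ∉ D := by
    by_contra h
    push Not at h
    have : D = ⊤ := top_le_iff.1 fun x _ => h x
    rw [← Subgroup.index_eq_one] at this
    exact hprime.one_lt.ne' this
  have hDn : D.Normal := inferInstance
  have htop : ∀ M : Subgroup G, D ≤ M → t ∈ M → M = ⊤ := fun M h1 h2 =>
    eq_top_of_prime_index hprime h1 ht h2
  have hcyc : IsCyclic (G ⧸ D) := by
    have : Fact (commutator G).index.Prime := ⟨hprime⟩
    exact isCyclic_of_prime_card (p := (commutator G).index) (Subgroup.index_eq_card _).symm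
  set c₁ := t * c * t⁻¹ with hc₁
  have hc₁D : c₁ ∈ D := hDn.conj_mem c hc t
  have hconjmem : ∀ {K : Subgroup G} {x g : G}, x ∈ normalizer (K : Set G) → g ∈ K →
      x * g * x⁻¹ ∈ K := fun hx hg => (mem_normalizer_iff.1 hx _).1 hg
  -- Otherwise H is normal in G and G'/H, of order two, is central in G/H, which forces G' ≤ H.
  have hc₁H : c₁ ∉ H := by
    intro hmem
    have htn : t ∈ normalizer (H : Set G) := by
      apply mem_normalizer_fintype
      rintro _ ⟨i, rfl⟩
      have : t * c ^ i * t⁻¹ = c₁ ^ i := by rw [hc₁, conj_zpow]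
      simp only
      rw [this]
      exact zpow_mem hmem i
    have hHn : H.Normal := normalizer_eq_top_iff.1 (htop _ hnormD htn)
    have hle : D ≤ H := by
      refine commutator_le_of_isCyclic_quotient H hHD ?_
      intro g d hd
      by_cases hdH : d ∈ H
      · exact mul_mem (hHn.conj_mem d hdH g) (inv_mem hdH)
      · refine hmul _ (hDn.conj_mem d hd g) _ (inv_mem hd) ?_ ?_
        · intro h
          have := hHn.conj_mem _ h g⁻¹
          apply hdH
          simpa [mul_assoc] using this
        · rwa [inv_mem_iff]
    have := Subgroup.relIndex_eq_one.2 hle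
    omega
  -- normality of `Z`
  have hc2Z : c ^ 2 ∈ Z := mem_zpowers _
  have hZH : Z ≤ H := by
    rw [hZ, zpowers_le]
    exact pow_mem hcH 2
  have hsq : ∀ g ∈ H, g ^ 2 ∈ Z := by
    rintro _ ⟨i, rfl⟩
    refine ⟨i, ?_⟩
    simp only
    rw [← zpow_natCast, ← zpow_natCast, ← zpow_mul, ← zpow_mul, mul_comm]
  have hord2 : orderOf (c ^ 2) = orderOf c / 2 := by
    rw [orderOf_pow, Nat.gcd_eq_right hev.two_dvd]
  -- The element c₁ ^ 2 lies in the cyclic group H and has the same order as c ^ 2, so it belongs to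
  -- the unique subgroup Z of that order.
  have hc₁sq : c₁ ^ 2 ∈ Z := by
    have h1 : c₁ ^ 2 ∈ H := by
      rw [sq]
      exact hmul _ hc₁D _ hc₁D hc₁H hc₁H
    obtain ⟨i, hi⟩ := (isOfFinOrder_of_finite c).mem_powers_iff_mem_zpowers.2 h1
    have h2 : orderOf (c₁ ^ 2) = orderOf c / 2 := by
      rw [← hord2, hc₁, conj_pow]
      exact MulEquiv.orderOf_eq (MulAut.conj t) (c ^ 2)
    simp only at hi
    rw [← hi, orderOf_pow] at h2
    have h3 : 2 ∣ i := by
      obtain ⟨w, hw⟩ := Nat.gcd_dvd_left (orderOf c) i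
      have hgpos : 0 < (orderOf c).gcd i := Nat.gcd_pos_of_pos_left _ hpos
      rw [Nat.div_eq_of_eq_mul_right hgpos hw] at h2
      have h5 : (orderOf c).gcd i * w = 2 * w := by
        rw [← hw, h2, Nat.mul_div_cancel' hev.two_dvd]
      have hwpos : 0 < w := by
        by_contra h
        rw [Nat.eq_zero_of_not_pos h] at hw
        omega
      rw [← Nat.eq_of_mul_eq_mul_right hwpos h5]
      exact Nat.gcd_dvd_right _ _
    obtain ⟨j, rfl⟩ := h3
    rw [← hi, pow_mul]
    exact pow_mem hc2Z j
  have hZn : Z.Normal := by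
    rw [← normalizer_eq_top_iff]
    refine htop _ ?_ ?_
    · intro d hd
      apply mem_normalizer_fintype
      rintro _ ⟨i, rfl⟩
      have : d * (c ^ 2) ^ i * d⁻¹ = (d * c ^ i * d⁻¹) ^ 2 := by
        rw [conj_pow, ← zpow_natCast, ← zpow_natCast, ← zpow_mul, ← zpow_mul, mul_comm]
      simp only
      rw [this]
      exact hsq _ (hconjmem (hnormD hd) (zpow_mem hcH i))
    · apply mem_normalizer_fintype
      rintro _ ⟨i, rfl⟩
      simp only
      rw [← conj_zpow, ← conj_pow]
      exact zpow_mem hc₁sq i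
  -- the quotient by `Z`
  let π := QuotientGroup.mk' Z
  have hπ1 : ∀ x, π x = 1 ↔ x ∈ Z := fun x => QuotientGroup.eq_one_iff x
  have hcZ : c ∉ Z := by
    intro h
    have h1 := orderOf_dvd_of_mem_zpowers h
    have h2 := Nat.le_of_dvd (by rw [hord2]; obtain ⟨s, hs⟩ := hev; omega) h1
    rw [hord2] at h2
    omega
  set u := π c with hu
  set v := π c₁ with hv
  set τ := π t with hτ
  have hu1 : u ≠ 1 := fun h => hcZ ((hπ1 c).1 h)
  have huu : u * u = 1 := by
    rw [hu, ← map_mul, ← sq, hπ1]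
    exact hc2Z
  have hvv : v * v = 1 := by
    rw [hv, ← map_mul, ← sq, hπ1]
    exact hc₁sq
  have hHmem : ∀ x, x ∈ H ↔ π x = 1 ∨ π x = u := by
    intro x
    constructor
    · rintro ⟨i, rfl⟩
      rcases Int.even_or_odd' i with ⟨j, rfl | rfl⟩
      · left
        simp only [map_zpow]
        rw [← hu, zpow_mul, zpow_two, huu, one_zpow]
      · right
        simp only [map_zpow]
        rw [← hu, zpow_add, zpow_mul, zpow_two, huu, one_zpow, one_mul, zpow_one]
    · rintro (h | h)
      · exact hZH ((hπ1 x).1 h)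
      · have : π (x * c⁻¹) = 1 := by rw [map_mul, map_inv, h, hu, mul_inv_cancel]
        have := mul_mem (hZH ((hπ1 _).1 this)) hcH
        simpa using this
  have hv1 : v ≠ 1 := fun h => hc₁H ((hHmem _).2 (Or.inl h))
  have hvu : v ≠ u := fun h => hc₁H ((hHmem _).2 (Or.inr h))
  have hτu : τ * u * τ⁻¹ = v := by rw [hv, hc₁, map_mul, map_mul, map_inv]
  have hcomm : v * u * v⁻¹ = u := by
    have h1 : π (c₁ * c * c₁⁻¹) = 1 ∨ π (c₁ * c * c₁⁻¹) = u :=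
      (hHmem _).1 (hconjmem (hnormD hc₁D) hcH)
    rw [map_mul, map_mul, map_inv, ← hu, ← hv] at h1
    rcases h1 with h | h
    · rw [conj_eq_one_iff] at h
      exact absurd h hu1
    · exact h
  have hDmem : ∀ d ∈ D, d ∈ H ∨ d * c₁⁻¹ ∈ H := by
    intro d hd
    by_cases h : d ∈ H
    · exact Or.inl h
    · exact Or.inr (hmul _ hd _ (inv_mem hc₁D) h (by rwa [inv_mem_iff]))
  have hτq : ∀ g : G, g ∈ D → π g * u * (π g)⁻¹ = u := by
    intro g hg
    have h1 := (hHmem _).1 (hconjmem (hnormD hg) hcH)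
    rw [map_mul, map_mul, map_inv, ← hu] at h1
    rcases h1 with h | h
    · rw [conj_eq_one_iff] at h
      exact absurd h hu1
    · exact h
  have htq : t ^ D.index ∈ D := by
    rw [← QuotientGroup.eq_one_iff, QuotientGroup.mk_pow, Subgroup.index_eq_card]
    exact pow_card_eq_one'
  have htq' := hτq _ htq
  rw [map_pow, ← hτ] at htq'
  have hmap : π (t * c₁ * t⁻¹) = τ * v * τ⁻¹ := by rw [map_mul, map_mul, map_inv]
  -- The image of v lies in {1, u, v, uv}; it is not 1, and not v because that is already the image
  -- of u.
  have hcases : τ * v * τ⁻¹ = u ∨ τ * v * τ⁻¹ = u * v := by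
    have h2 := hDmem (t * c₁ * t⁻¹) (hDn.conj_mem _ hc₁D t)
    rw [hHmem, hHmem, map_mul _ _ c₁⁻¹, map_inv, hmap] at h2
    rcases h2 with (h | h) | (h | h)
    · rw [conj_eq_one_iff] at h
      exact absurd h hv1
    · exact Or.inl h
    · rw [mul_inv_eq_one] at h
      have h3 := mul_left_cancel (mul_right_cancel (h.trans hτu.symm))
      exact absurd h3 hvu
    · exact Or.inr (mul_inv_eq_iff_eq_mul.1 h)
  have huv : u * v = v * u := (mul_inv_eq_iff_eq_mul.1 hcomm).symm
  obtain ⟨hq3, hw⟩ := eq_three_of_conj_pow_prime hprime hne2 hτu hcases hvu huv hvv htq'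
  refine ⟨hq3, hZn, t, ht, ?_, ?_, ?_⟩
  · intro M hcM hc₁M d hd
    have hHM : H ≤ M := by simpa [hH] using hcM
    rcases hDmem d hd with h | h
    · exact hHM h
    · have h2 := mul_mem (hHM h) hc₁M
      rwa [← hc₁, inv_mul_cancel_right] at h2
  · rw [← hπ1, map_mul, map_mul, map_mul, map_inv, map_inv, ← hu, ← hv, hcomm, mul_inv_cancel]
  · change (c * c₁)⁻¹ * (t * c₁ * t⁻¹) ∈ Z
    rw [← hπ1, map_mul, hmap, hw, map_inv, map_mul, inv_mul_cancel]

end PrimeIndex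

/-! ### The 2-part and the odd part of the commutator subgroup. -/

section PrimeIndex

open Subgroup

variable {G : Type*} [Group G]

theorem mem_normalizer_closure [Finite G] {S : Set G} {x : G}
    (h : ∀ s ∈ S, x * s * x⁻¹ ∈ closure S) : x ∈ normalizer (closure S : Set G) := by
  apply mem_normalizer_fintype
  intro g hg
  have h1 : closure S ≤ (closure S).comap (MulAut.conj x).toMonoidHom :=
    (closure_le _).2 fun s hs => h s hs
  exact h1 hg

theorem conj_pow_three_of_conj_eq_zpow {t x : G} {r : ℤ} (h : t * x * t⁻¹ = x ^ r) :
    t ^ 3 * x * (t ^ 3)⁻¹ = x ^ (r ^ 3) := by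
  have h2 : ∀ s : ℤ, t * x ^ s * t⁻¹ = x ^ (r * s) := by
    intro s
    rw [← conj_zpow, h, zpow_mul]
  calc t ^ 3 * x * (t ^ 3)⁻¹ = t * (t * (t * x * t⁻¹) * t⁻¹) * t⁻¹ := by
        simp only [pow_succ, pow_zero, one_mul, mul_inv_rev, mul_assoc]
    _ = x ^ (r ^ 3) := by
        rw [h, h2, h2]
        congr 1
        ring

/-- Moving b₁ ^ 2 past b costs a factor e ^ 2, but b₁ ^ 2 = b ^ 2 commutes with b. -/
theorem sq_eq_one_of_swap {b b₁ e : G} (heb₁ : Commute e b₁)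
    (h : b₁ * b = e * (b * b₁)) (hsq : b₁ ^ 2 = b ^ 2) : e ^ 2 = 1 := by
  have h1 : b₁ ^ 2 * b = e ^ 2 * (b * b₁ ^ 2) := by
    calc b₁ ^ 2 * b = b₁ * (b₁ * b) := by rw [sq, mul_assoc]
      _ = (b₁ * e) * (b * b₁) := by rw [h, mul_assoc]
      _ = e * (b₁ * b) * b₁ := by rw [← heb₁.eq]; simp only [mul_assoc]
      _ = e ^ 2 * (b * b₁ ^ 2) := by rw [h, sq, sq]; simp only [mul_assoc]
  rw [hsq, ← pow_succ, ← pow_succ'] at h1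
  exact mul_eq_right.1 h1.symm

theorem mul_sq_mul_sq_eq_one {b b₁ e z : G} (heb : Commute e b) (hzb : Commute z b)
    (hzb₁ : Commute z b₁) (h : b₁ * b = e * (b * b₁)) (hsq : b₁ ^ 2 = b ^ 2)
    (hb₂ : (b * b₁ * z) ^ 2 = b ^ 2) : e * b ^ 2 * z ^ 2 = 1 := by
  have hz : Commute (b * b₁) z := (hzb.mul_right hzb₁).symm
  rw [hz.mul_pow] at hb₂
  have h1 : (b * b₁) ^ 2 = b ^ 2 * (e * b ^ 2) := by
    calc (b * b₁) ^ 2 = b * (b₁ * b) * b₁ := by simp only [sq, mul_assoc]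
      _ = (b * e) * b * (b₁ ^ 2) := by rw [h, sq]; simp only [mul_assoc]
      _ = e * b * b * b ^ 2 := by rw [← heb.eq, hsq]
      _ = b ^ 2 * (e * b ^ 2) := by
        rw [← mul_assoc, ← (heb.pow_right 2).eq, sq]; simp only [mul_assoc]
  rw [h1, mul_assoc] at hb₂
  exact mul_eq_left.1 hb₂

/-- Here b and o are the 2-part and the odd part of c, b₁ is the conjugate of b under t, and r
describes conjugation by t on ⟨c²⟩. All of ⟨c²⟩ is central in G', so relations modulo ⟨c²⟩ lift with
central error terms e and z, which can be computed. The two conditions on subgroups M say that o, b,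
b₁ generate G', and that o can be recovered from o ^ (r - 1), b and b₁; the latter will make r - 1
invertible mod m. -/
theorem exists_quaternion_data [Finite G] (hprime : (commutator G).index.Prime)
    (hne2 : (commutator G).index ≠ 2) {c : G} (hc : c ∈ commutator G) (hev : Even (orderOf c))
    (hcard : Nat.card (commutator G) = 2 * orderOf c) :
    (commutator G).index = 3 ∧ ∃ (a m : ℕ) (o b b₁ : G) (r : ℤ), Odd m ∧ (a = 1 ∨ a = 2) ∧
      orderOf c = 2 ^ a * m ∧ orderOf o = m ∧ b ^ 2 ^ a = 1 ∧ b₁ ^ 2 = b ^ 2 ∧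
      b₁ * b * b₁⁻¹ = b⁻¹ ∧ Commute o b ∧ Commute o b₁ ∧ o ∈ commutator G ∧
      b ∈ commutator G ∧ b₁ ∈ commutator G ∧
      (∀ M : Subgroup G, o ∈ M → b ∈ M → b₁ ∈ M → commutator G ≤ M) ∧
      (∀ M : Subgroup G, o ^ (r - 1) ∈ M → b ∈ M → b₁ ∈ M → o ∈ M) ∧ (m : ℤ) ∣ r ^ 3 - 1 := by
  obtain ⟨hq3, hZn, t, ht, hgen, hcomm, hc₂⟩ :=
    exists_conj_of_card_commutator hprime hne2 hc hev hcard
  refine ⟨hq3, ?_⟩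
  set D := commutator G with hD
  set Z := zpowers (c ^ 2) with hZ
  have hDn : D.Normal := inferInstance
  have hcyc : IsCyclic (G ⧸ D) := by
    have : Fact (commutator G).index.Prime := ⟨hprime⟩
    exact isCyclic_of_prime_card (p := (commutator G).index) (Subgroup.index_eq_card _).symm
  have hZD : Z ≤ D := by
    rw [hZ, zpowers_le]
    exact pow_mem hc 2
  have hZc : ∀ {d z : G}, d ∈ D → z ∈ Z → Commute d z := fun hd hz =>
    commute_of_mem_commutator_of_isCyclic Z hd hz
  obtain ⟨a, m, hm, hn⟩ := Nat.exists_eq_two_pow_mul_odd (orderOf_pos c).ne'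
  have ha : a ≠ 0 := by
    rintro rfl
    rw [hn, pow_zero, one_mul] at hev
    exact Nat.not_even_iff_odd.2 hm hev
  have hmpos : 0 < m := hm.pos
  have hcop : Nat.Coprime m (2 ^ a) := (Nat.coprime_two_right.2 hm).pow_right a
  set π := QuotientGroup.mk' Z with hπ
  have hπ1 : ∀ x, π x = 1 ↔ x ∈ Z := fun x => QuotientGroup.eq_one_iff x
  set b := c ^ m with hb
  set o := c ^ 2 ^ a with ho
  have hbord : orderOf b = 2 ^ a := by
    rw [hb, orderOf_pow, hn, Nat.gcd_eq_right (dvd_mul_left _ _), Nat.mul_div_cancel _ hmpos]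
  have hoord : orderOf o = m := by
    rw [ho, orderOf_pow, hn, Nat.gcd_eq_right (dvd_mul_right _ _),
      Nat.mul_div_cancel_left _ (by positivity)]
  have hbD : b ∈ D := pow_mem hc m
  have hoD : o ∈ D := pow_mem hc _
  have hoZ : o ∈ Z := by
    obtain ⟨a', rfl⟩ := Nat.exists_eq_succ_of_ne_zero ha
    rw [ho, pow_succ', pow_mul]
    exact pow_mem (mem_zpowers _) _
  have hπb : π b = π c := by
    obtain ⟨i, hi⟩ := hm
    rw [hb, hi, pow_add, pow_mul, pow_one, map_mul, (hπ1 _).2 (pow_mem (mem_zpowers _) i), one_mul]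
  set b₁ := t * b * t⁻¹ with hb₁
  have hb₁D : b₁ ∈ D := hDn.conj_mem b hbD t
  have hπb₁ : π b₁ = π (t * c * t⁻¹) := by simp only [hb₁, map_mul, hπb]
  obtain ⟨r, hr⟩ : t * c ^ 2 * t⁻¹ ∈ Z := hZn.conj_mem _ (mem_zpowers _) t
  simp only at hr
  have ht3 : t ^ 3 ∈ D := by
    rw [← QuotientGroup.eq_one_iff, QuotientGroup.mk_pow, ← hq3, Subgroup.index_eq_card]
    exact pow_card_eq_one'
  have hconj : ∀ i : ℕ, t * (c ^ 2) ^ i * t⁻¹ = ((c ^ 2) ^ i) ^ r := by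
    intro i
    rw [← conj_pow, ← hr, ← zpow_natCast _ i, ← zpow_natCast _ i, ← zpow_mul, ← zpow_mul, mul_comm]
  -- The element t ^ 3 lies in G' and so centralizes Z, while it acts there as the power r ^ 3.
  have hr3 : ∀ i : ℕ, (orderOf ((c ^ 2) ^ i) : ℤ) ∣ r ^ 3 - 1 := by
    intro i
    have h1 := conj_pow_three_of_conj_eq_zpow (hconj i)
    rw [(hZc ht3 (pow_mem (mem_zpowers _) i)).eq, mul_inv_cancel_right] at h1
    rw [orderOf_dvd_iff_zpow_eq_one, zpow_sub_one, ← h1, mul_inv_cancel]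
  have hb2 : b ^ 2 = (c ^ 2) ^ m := by rw [hb, ← pow_mul, ← pow_mul, mul_comm]
  have hb2Z : b ^ 2 ∈ Z := hb2 ▸ pow_mem (mem_zpowers _) m
  -- The order of b ^ 2 is a power of two and r² + r + 1 is odd, so r³ ≡ 1 implies r ≡ 1 modulo this
  -- order.
  have htb2 : t * b ^ 2 * t⁻¹ = b ^ 2 := by
    rw [hb2, hconj, ← hb2]
    have h1 := hr3 m
    rw [← hb2] at h1
    obtain ⟨s, -, hs⟩ := (Nat.dvd_prime_pow Nat.prime_two).1
      (hbord ▸ orderOf_pow_dvd 2 : orderOf (b ^ 2) ∣ 2 ^ a)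
    have hodd : Odd (r ^ 2 + r + 1) := by
      have : Even (r ^ 2 + r) := by
        rw [show r ^ 2 + r = r * (r + 1) by ring]
        exact Int.even_mul_succ_self r
      exact this.add_one
    have h2 : IsCoprime (orderOf (b ^ 2) : ℤ) (r ^ 2 + r + 1) := by
      rw [hs]
      push_cast
      exact (Int.isCoprime_iff_gcd_eq_one.2 (by
        obtain ⟨w, hw⟩ := hodd
        rw [hw]
        exact Int.isCoprime_iff_gcd_eq_one.1 ⟨-w, 1, by ring⟩)).pow_left
    rw [show r ^ 3 - 1 = (r - 1) * (r ^ 2 + r + 1) by ring] at h1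
    have h3 := h2.dvd_of_dvd_mul_right h1
    rw [orderOf_dvd_iff_zpow_eq_one, zpow_sub_one, mul_inv_eq_one] at h3
    exact h3
  have hb₁sq : b₁ ^ 2 = b ^ 2 := by rw [hb₁, conj_pow, htb2]
  set b₂ := t * b₁ * t⁻¹ with hb₂
  have hb₂sq : b₂ ^ 2 = b ^ 2 := by rw [hb₂, conj_pow, hb₁sq, htb2]
  set e := b₁ * b * b₁⁻¹ * b⁻¹ with he
  set z := (b * b₁)⁻¹ * b₂ with hz
  have heZ : e ∈ Z := by
    rw [← hπ1] at hcomm ⊢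
    rw [← hcomm, he]
    simp only [map_mul, map_inv, hπb, hπb₁]
  have hzZ : z ∈ Z := by
    rw [← hπ1] at hc₂ ⊢
    rw [← hc₂, hz, hb₂]
    simp only [map_mul, map_inv, hπb, hπb₁]
  have hb₂z : b₂ = b * b₁ * z := by rw [hz, mul_inv_cancel_left]
  have hswap : b₁ * b = e * (b * b₁) := by
    rw [he]
    simp only [mul_assoc, inv_mul_cancel_left, inv_mul_cancel, mul_one]
  have he2 : e ^ 2 = 1 := sq_eq_one_of_swap (hZc hb₁D heZ).symm hswap hb₁sq
  have hrel : e * b ^ 2 * z ^ 2 = 1 := mul_sq_mul_sq_eq_one (hZc hbD heZ).symm (hZc hbD hzZ).symm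
    (hZc hb₁D hzZ).symm hswap hb₁sq (hb₂z ▸ hb₂sq)
  have hem : e ^ m = e := by
    obtain ⟨i, hi⟩ := hm
    rw [hi, pow_succ, pow_mul, he2, one_pow, one_mul]
  obtain ⟨i, hi⟩ := hzZ
  simp only at hi
  have hzm : z ^ m = b ^ (2 * i) := by
    rw [← hi, hb, ← zpow_natCast, ← zpow_natCast, ← zpow_natCast, ← zpow_mul, ← zpow_mul,
      ← zpow_mul]
    congr 1
    push_cast
    ring
  -- Since e = e ^ m, the relation e = (b² z²)⁻¹ may be raised to the power m, which turns z =
  -- (c²)^i into a power of b.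
  have hebz : e = b ^ (-2 * (m + 2 * i : ℤ)) := by
    have h1 : e = (b ^ 2 * z ^ 2)⁻¹ := by
      rw [mul_assoc] at hrel
      exact eq_inv_of_mul_eq_one_left hrel
    have h2 : Commute (b ^ 2) (z ^ 2) := (hZc hbD ⟨i, hi⟩).pow_pow 2 2
    have h3 : (b ^ 2) ^ m = b ^ (2 * m : ℤ) := by
      rw [← pow_mul, ← zpow_natCast]
      push_cast
      rfl
    have h4 : (z ^ 2) ^ m = b ^ (4 * i : ℤ) := by
      rw [← pow_mul, mul_comm, pow_mul, hzm, ← zpow_natCast _ 2, ← zpow_mul]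
      congr 1
      push_cast
      ring
    rw [← hem, h1, inv_pow, h2.mul_pow, h3, h4, ← zpow_add, ← zpow_neg]
    congr 1
    ring
  have hmi : Odd (m + 2 * i : ℤ) := by
    have : Odd (m : ℤ) := by exact_mod_cast hm
    exact this.add_even (even_two_mul i)
  -- By e ^ 2 = 1, the order 2 ^ a of b divides 4(m + 2i), and m + 2i is odd.
  have h4 : (2 ^ a : ℤ) ∣ 4 := by
    rw [hebz, ← zpow_natCast, ← zpow_mul, ← orderOf_dvd_iff_zpow_eq_one, hbord] at he2
    have h5 : (2 ^ a : ℤ) ∣ 4 * (m + 2 * i : ℤ) := by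
      push_cast at he2
      rw [← dvd_neg, show -(4 * (m + 2 * i : ℤ)) = -2 * (m + 2 * i) * 2 by ring]
      exact he2
    refine IsCoprime.dvd_of_dvd_mul_right ?_ h5
    obtain ⟨w, hw⟩ := hmi
    rw [hw]
    exact IsCoprime.pow_left ⟨-w, 1, by ring⟩
  have h4' : 2 ^ a ∣ 4 := by exact_mod_cast h4
  have ha2 : a = 1 ∨ a = 2 := by
    have : a ≤ 2 := (Nat.pow_dvd_pow_iff_le_right' (b := 0)).1 (by simpa using h4')
    omega
  have hb4 : b ^ 4 = 1 := by
    rw [← orderOf_dvd_iff_pow_eq_one, hbord]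
    exact h4'
  have heb2 : e = b ^ 2 := by
    rw [hebz, ← zpow_natCast, ← mul_inv_eq_one, ← zpow_neg, ← zpow_add]
    obtain ⟨w, hw⟩ := hmi
    rw [hw, show -2 * (2 * w + 1) + -((2 : ℕ) : ℤ) = ((4 : ℕ) : ℤ) * (-w - 1) by push_cast; ring,
      zpow_mul, zpow_natCast, hb4, one_zpow]
  have hinv : b₁ * b * b₁⁻¹ = b⁻¹ := by
    have h5 : b₁ * b * b₁⁻¹ = e * b := by rw [he, inv_mul_cancel_right]
    rw [h5, heb2, ← pow_succ, eq_inv_iff_mul_eq_one, ← pow_succ, hb4]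
  have hz1 : z ^ 2 = 1 := by
    rw [heb2, ← pow_add, hb4, one_mul] at hrel
    exact hrel
  have hzb : z = b ^ (2 * i) := by
    rw [← hzm]
    obtain ⟨w, hw⟩ := hm
    rw [hw, pow_succ, pow_mul, hz1, one_pow, one_mul]
  have hto : t * o * t⁻¹ = o ^ r := by
    obtain ⟨a', rfl⟩ := Nat.exists_eq_succ_of_ne_zero ha
    rw [ho, pow_succ', pow_mul]
    exact hconj _
  have hcbo : c = b ^ (m.gcdA (2 ^ a)) * o ^ (m.gcdB (2 ^ a)) := by
    have h5 := Nat.gcd_eq_gcd_ab m (2 ^ a)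
    rw [hcop.gcd_eq_one] at h5
    rw [hb, ho, ← zpow_natCast, ← zpow_natCast, ← zpow_mul, ← zpow_mul, ← zpow_add, ← h5,
      Nat.cast_one, zpow_one]
  have hgenD : ∀ M : Subgroup G, o ∈ M → b ∈ M → b₁ ∈ M → D ≤ M := by
    intro M hoM hbM hb₁M
    refine hgen M ?_ ?_
    · rw [hcbo]
      exact mul_mem (zpow_mem hbM _) (zpow_mem hoM _)
    · rw [hcbo, ← conj_mul, ← conj_zpow, ← conj_zpow, hto]
      exact mul_mem (zpow_mem hb₁M _) (zpow_mem (zpow_mem hoM _) _)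
  have hob : Commute o b := (hZc hbD hoZ).symm
  have hob₁ : Commute o b₁ := (hZc hb₁D hoZ).symm
  refine ⟨a, m, o, b, b₁, r, hm, ha2, hn, hoord, hbord ▸ pow_orderOf_eq_one b, hb₁sq, hinv, hob,
    hob₁, hoD, hbD, hb₁D, hgenD, ?_, ?_⟩
  -- The group N generated by b, b₁ and o ^ (r - 1) is normal in G. Modulo N, b and b₁ vanish and o
  -- commutes with t, so G'/N is central; as G/G' is cyclic, N contains G' and hence o.
  · intro M h1 h2 h3
    have hNM : closure {b, b₁, o ^ (r - 1)} ≤ M := by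
      rw [closure_le]
      rintro x (rfl | rfl | rfl)
      exacts [h2, h3, h1]
    set N := closure {b, b₁, o ^ (r - 1)} with hN
    have hbN : b ∈ N := subset_closure (by simp)
    have hb₁N : b₁ ∈ N := subset_closure (by simp)
    have hoN : o ^ (r - 1) ∈ N := subset_closure (by simp)
    have hND : N ≤ D := by
      rw [hN, closure_le]
      rintro x (rfl | rfl | rfl)
      exacts [hbD, hb₁D, zpow_mem hoD _]
    have hNn : N.Normal := by
      rw [← normalizer_eq_top_iff]
      refine eq_top_of_prime_index hprime (t := t) (hgenD _ ?_ (le_normalizer hbN)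
        (le_normalizer hb₁N)) ht ?_
      · apply mem_normalizer_closure
        rintro x (rfl | rfl | rfl)
        · rwa [hob.eq, mul_inv_cancel_right]
        · rwa [hob₁.eq, mul_inv_cancel_right]
        · rwa [((Commute.refl o).zpow_right _).eq, mul_inv_cancel_right]
      · apply mem_normalizer_closure
        rintro x (rfl | rfl | rfl)
        · exact hb₁N
        · change b₂ ∈ N
          rw [hb₂z, hzb]
          exact mul_mem (mul_mem hbN hb₁N) (zpow_mem hbN _)
        · rw [← conj_zpow, hto, ← zpow_mul, mul_comm, zpow_mul]
          exact zpow_mem hoN _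
    let ρ := QuotientGroup.mk' N
    have hρ1 : ∀ x, ρ x = 1 ↔ x ∈ N := fun x => QuotientGroup.eq_one_iff x
    have hocen : (centralizer {ρ o}).comap ρ = ⊤ := by
      refine eq_top_of_prime_index hprime (t := t) ?_ ht ?_
      · intro d hd
        rw [mem_comap, mem_centralizer_singleton_iff, ← map_mul, ← map_mul, (hZc hd hoZ).eq]
      · rw [mem_comap, mem_centralizer_singleton_iff, ← mul_inv_eq_iff_eq_mul, ← map_inv,
          ← map_mul, ← map_mul, hto, ← mul_inv_eq_one, ← map_inv, ← map_mul, hρ1, ← zpow_sub_one]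
        exact hoN
    have hcen : D ≤ (center (G ⧸ N)).comap ρ := by
      refine hgenD _ ?_ ?_ ?_
      · rw [mem_comap, mem_center_iff]
        intro y
        obtain ⟨g, rfl⟩ := QuotientGroup.mk'_surjective N y
        have : g ∈ (centralizer {ρ o}).comap ρ := hocen ▸ mem_top g
        rwa [mem_comap, mem_centralizer_singleton_iff] at this
      · rw [mem_comap, (hρ1 b).2 hbN]
        exact one_mem _
      · rw [mem_comap, (hρ1 b₁).2 hb₁N]
        exact one_mem _
    apply hNM
    refine commutator_le_of_isCyclic_quotient N hND ?_ hoD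
    intro g d hd
    have h5 := mem_center_iff.1 (hcen hd) (ρ g)
    rw [← hρ1, map_mul, map_mul, map_mul, map_inv, map_inv, h5, mul_inv_cancel_right,
      mul_inv_cancel]
  · have h5 : o = (c ^ 2) ^ 2 ^ (a - 1) := by
      rw [← pow_mul, ← pow_succ', Nat.sub_add_cancel (Nat.pos_of_ne_zero ha)]
    have h6 := hr3 (2 ^ (a - 1))
    rwa [← h5, hoord] at h6

end PrimeIndex

/-! ### Homomorphisms from ℤ/n, Q₈ and the four-group, and the splitting of G over G'. -/

section PrimeIndex

open Subgroup

variable {G : Type*} [Group G]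

/-- The homomorphism from `ℤ/n` that sends `1` to `g`, for `g ^ n = 1`. -/
def zmodPowHom {n : ℕ} (g : G) (hg : g ^ n = 1) : Multiplicative (ZMod n) →* G :=
  AddMonoidHom.toMultiplicativeLeft
    (ZMod.lift n ⟨zmultiplesHom (Additive G) (Additive.ofMul g), by
      rw [zmultiplesHom_apply, natCast_zsmul, ← ofMul_pow, hg]
      rfl⟩)

theorem zmodPowHom_apply {n : ℕ} (g : G) (hg : g ^ n = 1) (j : ℤ) :
    zmodPowHom g hg (Multiplicative.ofAdd (j : ZMod n)) = g ^ j := by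
  simp [zmodPowHom]

theorem zmodPowHom_one {n : ℕ} (g : G) (hg : g ^ n = 1) :
    zmodPowHom g hg (Multiplicative.ofAdd 1) = g := by
  have := zmodPowHom_apply g hg 1
  rwa [Int.cast_one, zpow_one] at this

theorem zmodPowHom_mem_zpowers {n : ℕ} (g : G) (hg : g ^ n = 1) (x : Multiplicative (ZMod n)) :
    ∃ j : ℤ, zmodPowHom g hg x = g ^ j := by
  obtain ⟨j, hj⟩ := ZMod.intCast_surjective (Multiplicative.toAdd x)
  refine ⟨j, ?_⟩
  rw [← zmodPowHom_apply g hg, hj]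
  rfl

/-- Schur–Zassenhaus provides a complement, which has order three. -/
theorem exists_mulEquiv_semidirectProduct [Finite G] {N : Subgroup G} [N.Normal] {N' : Type*}
    [Group N'] (e : N ≃* N') (hcop : (Nat.card N).Coprime N.index) (hidx : N.index = 3) :
    ∃ φ : Multiplicative (ZMod 3) →* MulAut N',
      Nonempty (G ≃* N' ⋊[φ] Multiplicative (ZMod 3)) := by
  obtain ⟨K, hK⟩ := Subgroup.exists_right_complement'_of_coprime hcop
  have hcard : Nat.card K = 3 := by rw [← hK.symm.index_eq_card, hidx]
  have : Fact (Nat.Prime 3) := ⟨Nat.prime_three⟩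
  have f : K ≃* Multiplicative (ZMod 3) := mulEquivOfPrimeCardEq hcard (by simp)
  exact ⟨_, ⟨(SemidirectProduct.mulEquivSubgroup hK).symm.trans (SemidirectProduct.congr' e f)⟩⟩

/-- The class of r has order exactly three in the unit group mod p, so 3 divides p - 1. -/
theorem Nat.Prime.mod_three_eq_one {p : ℕ} (hp : p.Prime) {r : ℤ} (h3 : (p : ℤ) ∣ r ^ 3 - 1)
    (h1 : ¬ (p : ℤ) ∣ r - 1) : p % 3 = 1 := by
  have : Fact p.Prime := ⟨hp⟩
  have : Fact (Nat.Prime 3) := ⟨Nat.prime_three⟩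
  have h3' : (r : ZMod p) ^ 3 = 1 := by
    rw [← sub_eq_zero]
    exact_mod_cast (ZMod.intCast_zmod_eq_zero_iff_dvd _ p).2 h3
  have h1' : (r : ZMod p) ≠ 1 := by
    intro h
    rw [← sub_eq_zero] at h
    exact h1 ((ZMod.intCast_zmod_eq_zero_iff_dvd _ p).1 (by exact_mod_cast h))
  have hord := orderOf_eq_prime h3' h1'
  have hne : (r : ZMod p) ≠ 0 := by
    intro h
    rw [h] at h3'
    simp at h3'
  have hdvd := ZMod.orderOf_dvd_card_sub_one hne
  rw [hord] at hdvd
  have := hp.two_le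
  omega

/-- W will be the four-group or Q₈. By cardinality, the surjection from ℤ/m × W to G' is bijective.
If a prime p ∣ m divided r - 1, the image of ⟨r - 1⟩ × W would not contain o, against `hr`; so r is
a nontrivial cube root of unity mod p. In particular 3 ∤ m, as the splitting needs. -/
theorem exists_semidirectProduct_of_hom [Finite G] {W : Type*} [Group W] [Finite W] (f : W →* G)
    {o : G} {m : ℕ} {r : ℤ} (hidx : (commutator G).index = 3) (hom : orderOf o = m)
    (hcomm : ∀ w, Commute o (f w)) (hoD : o ∈ commutator G) (hfD : f.range ≤ commutator G)
    (hcard : Nat.card (commutator G) = m * Nat.card W) (hW : Nat.Coprime (Nat.card W) 3)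
    (hgen : ∀ M : Subgroup G, o ∈ M → f.range ≤ M → commutator G ≤ M)
    (hr : ∀ M : Subgroup G, o ^ (r - 1) ∈ M → f.range ≤ M → o ∈ M) (hr3 : (m : ℤ) ∣ r ^ 3 - 1) :
    (∀ p : ℕ, p.Prime → p ∣ m → p % 3 = 1) ∧
      ∃ φ : Multiplicative (ZMod 3) →* MulAut (Multiplicative (ZMod m) × W),
        Nonempty (G ≃* (Multiplicative (ZMod m) × W) ⋊[φ] Multiplicative (ZMod 3)) := by
  have hmpos : 0 < m := hom ▸ orderOf_pos o
  have : NeZero m := ⟨hmpos.ne'⟩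
  have hom1 : o ^ m = 1 := hom ▸ pow_orderOf_eq_one o
  let Φ : Multiplicative (ZMod m) × W →* G :=
    MonoidHom.noncommCoprod (zmodPowHom o hom1) f (by
      intro x w
      obtain ⟨j, hj⟩ := zmodPowHom_mem_zpowers o hom1 x
      rw [hj]
      exact (hcomm w).zpow_left j)
  have hΦ : ∀ x w, Φ (x, w) = zmodPowHom o hom1 x * f w := fun x w => rfl
  have hΦo : Φ (Multiplicative.ofAdd 1, 1) = o := by
    rw [hΦ, zmodPowHom_one, map_one, mul_one]
  have hΦf : ∀ w, Φ (1, w) = f w := by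
    intro w
    rw [hΦ, map_one, one_mul]
  have hΦD : ∀ x, Φ x ∈ commutator G := by
    rintro ⟨x, w⟩
    obtain ⟨j, hj⟩ := zmodPowHom_mem_zpowers o hom1 x
    rw [hΦ, hj]
    exact mul_mem (zpow_mem hoD j) (hfD ⟨w, rfl⟩)
  let Ψ : Multiplicative (ZMod m) × W →* commutator G := Φ.codRestrict _ hΦD
  have hΨ : Function.Bijective Ψ := by
    refine Function.Surjective.bijective_of_nat_card_le ?_ ?_
    · rintro ⟨d, hd⟩
      have h1 : commutator G ≤ Φ.range := by
        refine hgen _ ⟨_, hΦo⟩ ?_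
        rintro _ ⟨w, rfl⟩
        exact ⟨_, hΦf w⟩
      obtain ⟨x, hx⟩ := h1 hd
      exact ⟨x, Subtype.ext hx⟩
    · rw [hcard, Nat.card_prod]
      simp
  have hΦinj : Function.Injective Φ := fun x y h => hΨ.1 (Subtype.ext h)
  have hprimes : ∀ p : ℕ, p.Prime → p ∣ m → p % 3 = 1 := by
    intro p hp hpm
    have hpm' : (p : ℤ) ∣ m := by exact_mod_cast hpm
    refine hp.mod_three_eq_one (hpm'.trans hr3) ?_
    intro hpr
    let K : Subgroup (Multiplicative (ZMod m)) :=
      zpowers (Multiplicative.ofAdd ((r - 1 : ℤ) : ZMod m))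
    have hoM : o ∈ (K.prod (⊤ : Subgroup W)).map Φ := by
      apply hr
      · refine ⟨(Multiplicative.ofAdd ((r - 1 : ℤ) : ZMod m), 1), ⟨mem_zpowers _, mem_top _⟩, ?_⟩
        rw [hΦ, zmodPowHom_apply, map_one, mul_one]
      · rintro _ ⟨w, rfl⟩
        exact ⟨(1, w), ⟨one_mem _, mem_top _⟩, hΦf w⟩
    obtain ⟨⟨x, w⟩, ⟨⟨j, hj⟩, -⟩, hxo⟩ := hoM
    rw [← hΦo] at hxo
    have h1 := congrArg Prod.fst (hΦinj hxo)
    simp only at hj h1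
    rw [← hj, ← ofAdd_zsmul] at h1
    have h2 : j • ((r - 1 : ℤ) : ZMod m) = 1 := Multiplicative.ofAdd.injective h1
    rw [zsmul_eq_mul, ← Int.cast_mul] at h2
    have h3 := hpm'.trans ((ZMod.intCast_eq_intCast_iff_dvd_sub (j * (r - 1)) 1 m).1
      (by rw [h2, Int.cast_one]))
    have h4 : (p : ℤ) ∣ 1 := by
      have := dvd_add h3 (hpr.mul_left j)
      simpa using this
    have h5 : p ∣ 1 := by exact_mod_cast h4
    exact hp.one_lt.ne' (Nat.dvd_one.1 h5)
  refine ⟨hprimes, ?_⟩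
  refine exists_mulEquiv_semidirectProduct (MulEquiv.ofBijective Ψ hΨ).symm ?_ hidx
  rw [hidx, hcard]
  refine Nat.Coprime.mul_left ?_ hW
  rw [Nat.coprime_comm, Nat.Prime.coprime_iff_not_dvd Nat.prime_three]
  intro h
  have := hprimes 3 Nat.prime_three h
  omega

/-- The homomorphism from the quaternion group determined by two elements that satisfy the defining
relations. -/
def quaternionHom (b b₁ : G) (hb : b ^ (2 * 2) = 1) (hsq : b₁ ^ 2 = b ^ 2)
    (hinv : b₁ * b * b₁⁻¹ = b⁻¹) : QuaternionGroup 2 →* G :=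
  let f : ZMod (2 * 2) → G := fun i => zmodPowHom b hb (Multiplicative.ofAdd i)
  have hf : ∀ i j, f (i + j) = f i * f j := fun i j => by simp only [f, ofAdd_add, map_mul]
  have hswap : ∀ i, f i * b₁ = b₁ * f (-i) := by
    intro i
    obtain ⟨j, rfl⟩ := ZMod.intCast_surjective i
    simp only [f, ← Int.cast_neg, zmodPowHom_apply]
    have h := conj_zpow (a := b₁) (b := b) (i := -j)
    rw [hinv, inv_zpow, zpow_neg, inv_inv, ← zpow_neg, eq_mul_inv_iff_mul_eq] at h
    exact h
  have hf2 : f 2 = b₁ * b₁ := (zmodPowHom_apply b hb 2).trans ((zpow_ofNat b 2).trans (hsq.symm.trans (sq b₁)))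
  MonoidHom.mk' (fun x => match x with
    | .a i => f i
    | .xa i => b₁ * f i) (by
    rintro (i | i) (j | j)
    · simp only [QuaternionGroup.a_mul_a, hf]
    · simp only [QuaternionGroup.a_mul_xa]
      rw [← mul_assoc, hswap, mul_assoc, ← hf, sub_eq_neg_add]
    · simp only [QuaternionGroup.xa_mul_a, hf, mul_assoc]
    · simp only [QuaternionGroup.xa_mul_xa]
      rw [mul_assoc b₁, ← mul_assoc (f i), hswap, mul_assoc, ← mul_assoc, ← hf2, ← hf, ← hf]
      congr 1
      push_cast
      ring)

/-- Translates conditions on b and b₁ into the conditions on `f.range` used in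
`exists_semidirectProduct_of_hom`. -/
theorem range_quaternionHom_le_iff (b b₁ : G) (hb : b ^ (2 * 2) = 1) (hsq : b₁ ^ 2 = b ^ 2)
    (hinv : b₁ * b * b₁⁻¹ = b⁻¹) (M : Subgroup G) :
    (quaternionHom b b₁ hb hsq hinv).range ≤ M ↔ b ∈ M ∧ b₁ ∈ M := by
  constructor
  · intro h
    refine ⟨h ⟨.a 1, zmodPowHom_one b hb⟩, h ⟨.xa 0, ?_⟩⟩
    change b₁ * zmodPowHom b hb (Multiplicative.ofAdd 0) = b₁
    rw [ofAdd_zero, map_one, mul_one]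
  · rintro ⟨h1, h2⟩ _ ⟨i | i, rfl⟩
    · obtain ⟨j, hj⟩ := zmodPowHom_mem_zpowers b hb (Multiplicative.ofAdd i)
      exact hj ▸ zpow_mem h1 j
    · obtain ⟨j, hj⟩ := zmodPowHom_mem_zpowers b hb (Multiplicative.ofAdd i)
      change b₁ * zmodPowHom b hb (Multiplicative.ofAdd i) ∈ M
      rw [hj]
      exact mul_mem h2 (zpow_mem h1 j)

/-- The homomorphism from the four-group determined by two commuting elements whose squares are
trivial. -/
def kleinHom (b b₁ : G) (hb : b ^ 2 = 1) (hb₁ : b₁ ^ 2 = 1) (hcomm : Commute b b₁) :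
    Multiplicative (ZMod 2) × Multiplicative (ZMod 2) →* G :=
  MonoidHom.noncommCoprod (zmodPowHom b hb) (zmodPowHom b₁ hb₁) (by
    intro x y
    obtain ⟨i, hi⟩ := zmodPowHom_mem_zpowers b hb x
    obtain ⟨j, hj⟩ := zmodPowHom_mem_zpowers b₁ hb₁ y
    rw [hi, hj]
    exact (hcomm.zpow_left i).zpow_right j)

theorem range_kleinHom_le_iff (b b₁ : G) (hb : b ^ 2 = 1) (hb₁ : b₁ ^ 2 = 1)
    (hcomm : Commute b b₁) (M : Subgroup G) :
    (kleinHom b b₁ hb hb₁ hcomm).range ≤ M ↔ b ∈ M ∧ b₁ ∈ M := by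
  have happ : ∀ x y, kleinHom b b₁ hb hb₁ hcomm (x, y) =
    zmodPowHom b hb x * zmodPowHom b₁ hb₁ y := fun x y => rfl
  constructor
  · intro h
    refine ⟨h ⟨(Multiplicative.ofAdd 1, 1), ?_⟩, h ⟨(1, Multiplicative.ofAdd 1), ?_⟩⟩
    · rw [happ, zmodPowHom_one, map_one, mul_one]
    · rw [happ, zmodPowHom_one, map_one, one_mul]
  · rintro ⟨h1, h2⟩ _ ⟨⟨x, y⟩, rfl⟩
    obtain ⟨i, hi⟩ := zmodPowHom_mem_zpowers b hb x
    obtain ⟨j, hj⟩ := zmodPowHom_mem_zpowers b₁ hb₁ y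
    rw [happ, hi, hj]
    exact mul_mem (zpow_mem h1 i) (zpow_mem h2 j)

theorem commute_range_of_commute {W : Type*} [Group W] (f : W →* G) {o : G}
    (h : f.range ≤ centralizer {o}) (w : W) : Commute o (f w) :=
  (mem_centralizer_singleton_iff.1 (h ⟨w, rfl⟩)).symm

end PrimeIndex

/-! ### The structure of admissible groups. -/

theorem IsAdmissible.index_commutator {k q : ℕ} (hk : Odd k) (hq : q.Prime) (hq2 : q ≠ 2)
    {G : Type u} [Group G] {x y : G} (h : IsAdmissible k q G x y) :
    (commutator G).index = q ∧ Nat.card (commutator G) = 2 * (k + 1) := by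
  obtain ⟨hcard, -, hord⟩ := h
  have hqpos := hq.pos
  have hne : Nat.card G ≠ 0 := by rw [hcard]; positivity
  have : Finite G := Nat.finite_of_card_ne_zero hne
  set c := x * y * x⁻¹ * y⁻¹ with hc
  have hcD : c ∈ commutator G :=
    Subgroup.commutator_mem_commutator (Subgroup.mem_top x) (Subgroup.mem_top y)
  have hidx : (Subgroup.zpowers c).index = 2 * q := by
    have h1 := (Subgroup.zpowers c).card_mul_index
    rw [Nat.card_zpowers, hord, hcard] at h1
    exact Nat.eq_of_mul_eq_mul_left (show 0 < k + 1 by omega) (by rw [h1]; ring)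
  have hle : Subgroup.zpowers c ≤ commutator G := by simpa using hcD
  have hdvd : (commutator G).index ∣ 2 * q := hidx ▸ Subgroup.index_dvd_of_le hle
  have hsqf : Squarefree (2 * q) := by
    rw [Nat.squarefree_mul ((Nat.coprime_primes Nat.prime_two hq).2 hq2.symm)]
    exact ⟨Nat.prime_two.prime.squarefree, hq.prime.squarefree⟩
  have hcyc : IsCyclic (G ⧸ commutator G) := by
    have : IsZGroup (Abelianization G) := IsZGroup.of_squarefree (by
      refine hsqf.squarefree_of_dvd (dvd_trans ?_ hdvd)
      rw [Subgroup.index_eq_card]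
      exact dvd_rfl)
    exact (inferInstance : IsCyclic (Abelianization G))
  have heven := even_card_commutator_div_orderOf hcD (hord ▸ hk.add_one)
  rw [hord] at heven
  have hmul := (commutator G).card_mul_index
  rw [hcard] at hmul
  -- Index 1 is the perfect case. Index 2 or 2q would make |G'|/(k + 1) equal to q or 1, both odd.
  rcases Nat.dvd_two_mul_prime hq hdvd with h | h | h | h
  · exact absurd (Subgroup.index_eq_one.1 h)
      (commutator_ne_top_of_isCyclic_of_index hq hq2 (Subgroup.zpowers c) hidx)
  · exfalso
    rw [h] at hmul
    have h1 : Nat.card (commutator G) = (k + 1) * q :=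
      Nat.eq_of_mul_eq_mul_right two_pos (by rw [hmul]; ring)
    rw [h1, Nat.mul_div_cancel_left _ (Nat.succ_pos k)] at heven
    exact Nat.not_even_iff_odd.2 (hq.odd_of_ne_two hq2) heven
  · refine ⟨h, ?_⟩
    rw [h] at hmul
    exact Nat.eq_of_mul_eq_mul_right hqpos hmul
  · exfalso
    rw [h] at hmul
    have h1 : Nat.card (commutator G) = k + 1 :=
      Nat.eq_of_mul_eq_mul_right (m := 2 * q) (by omega) (by rw [hmul]; ring)
    rw [h1, Nat.div_self (Nat.succ_pos k)] at heven
    exact Nat.not_even_one heven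

theorem IsAdmissible.eq_three_and_type {k q : ℕ} (hk : Odd k) (hq : q.Prime) (hq2 : q ≠ 2)
    {G : Type u} [Group G] {x y : G} (h : IsAdmissible k q G x y) :
    q = 3 ∧
      ((k % 4 = 1 ∧ (∀ p : ℕ, p.Prime → p ∣ (k + 1) / 2 → p % 3 = 1) ∧
          IsKleinType ((k + 1) / 2) G) ∨
        (k % 4 = 3 ∧ (∀ p : ℕ, p.Prime → p ∣ (k + 1) / 4 → p % 3 = 1) ∧
          IsQuaternionType ((k + 1) / 4) G)) := by
  obtain ⟨hidx, hD⟩ := h.index_commutator hk hq hq2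
  obtain ⟨hcard, -, hord⟩ := h
  have hqpos := hq.pos
  have hne : Nat.card G ≠ 0 := by rw [hcard]; positivity
  have : Finite G := Nat.finite_of_card_ne_zero hne
  set c := x * y * x⁻¹ * y⁻¹ with hc
  have hcD : c ∈ commutator G :=
    Subgroup.commutator_mem_commutator (Subgroup.mem_top x) (Subgroup.mem_top y)
  obtain ⟨h3, a, m, o, b, b₁, r, hm, ha, hn, hom, hb, hb₁, hinv, hob, hob₁, hoD, hbD, hb₁D, hgen,
      hr, hr3⟩ := exists_quaternion_data (hidx ▸ hq) (hidx ▸ hq2) hcD (hord ▸ hk.add_one)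
    (by rw [hD, hord])
  refine ⟨hidx.symm.trans h3, ?_⟩
  rw [hord] at hn
  have hobM : b ∈ Subgroup.centralizer {o} ∧ b₁ ∈ Subgroup.centralizer {o} :=
    ⟨Subgroup.mem_centralizer_singleton_iff.2 hob.symm.eq,
      Subgroup.mem_centralizer_singleton_iff.2 hob₁.symm.eq⟩
  obtain ⟨w, hw⟩ := hm
  -- The exponent of 2 in k + 1 is 1 exactly for k ≡ 1 mod 4; then b and b₁ commute and have trivial
  -- squares. The exponent 2 gives k ≡ 3 mod 4 and the relations of Q₈.
  rcases ha with rfl | rfl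
  · left
    have hkm : (k + 1) / 2 = m := by omega
    have hb' : b ^ 2 = 1 := by simpa using hb
    have hb₁' : b₁ ^ 2 = 1 := hb₁.trans hb'
    have hcomm : Commute b b₁ := by
      have h1 : b⁻¹ = b := inv_eq_of_mul_eq_one_left (by rw [← sq, hb'])
      rw [h1] at hinv
      exact (mul_inv_eq_iff_eq_mul.1 hinv).symm
    have hle := range_kleinHom_le_iff b b₁ hb' hb₁' hcomm
    rw [hkm]
    refine ⟨by omega, exists_semidirectProduct_of_hom (kleinHom b b₁ hb' hb₁' hcomm) h3 hom
      (commute_range_of_commute _ ((hle _).2 hobM)) hoD ((hle _).2 ⟨hbD, hb₁D⟩) ?_ ?_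
      (fun M h1 h2 => hgen M h1 ((hle M).1 h2).1 ((hle M).1 h2).2)
      (fun M h1 h2 => hr M h1 ((hle M).1 h2).1 ((hle M).1 h2).2) hr3⟩
    · rw [hD, hn, Nat.card_prod]
      simp
      ring
    · rw [Nat.card_prod]
      simp only [Nat.card_eq_fintype_card]
      decide
  · right
    have hkm : (k + 1) / 4 = m := by omega
    have hb' : b ^ (2 * 2) = 1 := by simpa using hb
    have hle := range_quaternionHom_le_iff b b₁ hb' hb₁ hinv
    have hQ : Nat.card (QuaternionGroup 2) = 8 := by
      rw [Nat.card_eq_fintype_card, QuaternionGroup.card]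
    rw [hkm]
    refine ⟨by omega, exists_semidirectProduct_of_hom (quaternionHom b b₁ hb' hb₁ hinv) h3 hom
      (commute_range_of_commute _ ((hle _).2 hobM)) hoD ((hle _).2 ⟨hbD, hb₁D⟩) ?_ ?_
      (fun M h1 h2 => hgen M h1 ((hle M).1 h2).1 ((hle M).1 h2).2)
      (fun M h1 h2 => hr M h1 ((hle M).1 h2).1 ((hle M).1 h2).2) hr3⟩
    · rw [hD, hn, hQ]
      ring
    · rw [hQ]
      decide

/-! ### Construction of the groups -/

/-- Modulo p there is an element of order three because 3 ∣ p - 1. Hensel lifting reaches the powers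
of p, and the Chinese remainder theorem combines the primes. -/
theorem Int.exists_dvd_sq_add_self_add_one {l : ℕ} (hl : l ≠ 0)
    (h : ∀ p : ℕ, p.Prime → p ∣ l → p % 3 = 1) : ∃ a : ℤ, (l : ℤ) ∣ a ^ 2 + a + 1 := by
  induction l using Nat.recOnPosPrimePosCoprime with
  | zero => exact absurd rfl hl
  | one => exact ⟨0, by simp⟩
  | prime_pow p n hp hn =>
    have hp3 : p % 3 = 1 := h p hp (dvd_pow_self p (by omega))
    clear h hl
    induction n with
    | zero => omega
    | succ n ih =>
      have : Fact p.Prime := ⟨hp⟩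
      rcases Nat.eq_zero_or_pos n with rfl | hnpos
      · have h3 : 3 ∣ Nat.card (ZMod p)ˣ := by
          rw [Nat.card_eq_fintype_card, ZMod.card_units]
          omega
        have : Fact (Nat.Prime 3) := ⟨Nat.prime_three⟩
        obtain ⟨w, hw⟩ := exists_prime_orderOf_dvd_card' 3 h3
        obtain ⟨a, ha⟩ := ZMod.intCast_surjective (w : ZMod p)
        refine ⟨a, ?_⟩
        rw [zero_add, pow_one, ← ZMod.intCast_zmod_eq_zero_iff_dvd]
        push_cast
        rw [ha]
        have hw3 : (w : ZMod p) ^ 3 = 1 := by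
          have := pow_orderOf_eq_one w
          rw [hw] at this
          rw [← Units.val_pow_eq_pow_val, this, Units.val_one]
        have hw1 : (w : ZMod p) - 1 ≠ 0 := by
          intro h
          rw [sub_eq_zero, Units.val_eq_one] at h
          rw [h, orderOf_one] at hw
          omega
        have hprod : ((w : ZMod p) - 1) * ((w : ZMod p) ^ 2 + w + 1) = 0 := by
          linear_combination hw3
        exact (mul_eq_zero.1 hprod).resolve_left hw1
      · obtain ⟨a, u, hu⟩ := ih hnpos
        have hpn : (p : ℤ) ∣ a ^ 2 + a + 1 := by
          rw [hu]
          push_cast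
          exact Dvd.dvd.mul_right (dvd_pow_self _ hnpos.ne') u
        -- The derivative 2a + 1 is invertible mod p, because 4(a² + a + 1) - (2a + 1)² = 3 and p ≠
        -- 3.
        have hcop : IsCoprime (p : ℤ) (2 * a + 1) := by
          rw [(Nat.prime_iff_prime_int.1 hp).coprime_iff_not_dvd]
          intro hd
          have h3 : (p : ℤ) ∣ 3 := by
            have := dvd_sub (hpn.mul_left 4) (hd.mul_left (2 * a + 1))
            rwa [show 4 * (a ^ 2 + a + 1) - (2 * a + 1) * (2 * a + 1) = 3 by ring] at this
          have h3' : p ∣ 3 := by exact_mod_cast h3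
          rw [(Nat.prime_dvd_prime_iff_eq hp Nat.prime_three).1 h3'] at hp3
          omega
        obtain ⟨s, t, hst⟩ := hcop
        -- Newton step: a² + a + 1 = p^n u, and t inverts 2a + 1 mod p.
        refine ⟨a - p ^ n * (t * u), ?_⟩
        obtain ⟨n', rfl⟩ := Nat.exists_eq_succ_of_ne_zero hnpos.ne'
        refine ⟨s * u + p ^ n' * (t * u) ^ 2, ?_⟩
        push_cast at hu ⊢
        have e1 : (p : ℤ) ^ (n'.succ + 1) = p ^ n'.succ * p := pow_succ _ _
        have e2 : (p : ℤ) ^ n'.succ = p ^ n' * p := pow_succ _ _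
        rw [e1]
        rw [e2] at hu ⊢
        linear_combination hu - (p : ℤ) ^ n' * p * u * hst
  | coprime a b ha hb hab iha ihb =>
    obtain ⟨s, hs⟩ := iha (by omega) fun p hp hpa => h p hp (hpa.mul_right b)
    obtain ⟨t, ht⟩ := ihb (by omega) fun p hp hpb => h p hp (hpb.mul_left a)
    have hcop : IsCoprime (a : ℤ) b := Nat.isCoprime_iff_coprime.2 hab
    obtain ⟨u, v, huv⟩ := hcop
    -- This number is s mod a and t mod b.
    refine ⟨s * (v * b) + t * (u * a), ?_⟩
    push_cast
    refine IsCoprime.mul_dvd ⟨u, v, huv⟩ ?_ ?_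
    · have h1 : (a : ℤ) ∣ s * (v * b) + t * (u * a) - s :=
        ⟨u * (t - s), by linear_combination s * huv⟩
      have := dvd_add hs (h1.mul_right (s * (v * b) + t * (u * a) + s + 1))
      convert this using 1
      ring
    · have h1 : (b : ℤ) ∣ s * (v * b) + t * (u * a) - t :=
        ⟨v * (s - t), by linear_combination t * huv⟩
      have := dvd_add ht (h1.mul_right (s * (v * b) + t * (u * a) + t + 1))
      convert this using 1
      ring

theorem IsAdmissible.of_mulEquiv {k q : ℕ} {G G' : Type*} [Group G] [Group G'] (e : G ≃* G')
    {x y : G} (h : IsAdmissible k q G x y) : IsAdmissible k q G' (e x) (e y) := by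
  obtain ⟨h1, h2, h3⟩ := h
  refine ⟨(Nat.card_congr e.toEquiv).symm.trans h1, ?_, ?_⟩
  · have := congrArg (Subgroup.map e.toMonoidHom) h2
    rw [MonoidHom.map_closure, Subgroup.map_top_of_surjective _ e.surjective,
      Set.image_pair] at this
    exact this
  · rw [← map_inv, ← map_inv, ← map_mul, ← map_mul, ← map_mul, MulEquiv.orderOf_eq, h3]

/-- Given an automorphism `β` of order three of `W` such that `v` and `β v` generate `W`, and a
primitive third root of unity in `ℤ/l`, the group `(ℤ/l × W) ⋊ ℤ/3` has two generators whose
commutator has order `l * e`, where `e` is the order of `β v * v⁻¹`. -/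
theorem exists_isAdmissible_of_mulAut {k l e : ℕ} {W : Type} [Group W] [Finite W] (β : MulAut W)
    (hβ : β ^ 3 = 1) (v : W) (hgen : Subgroup.closure {v, β v} = ⊤)
    (he : orderOf (β v * v⁻¹) = e) (he1 : e ≠ 1) (hcard : Nat.card W = 2 * e) (hl : l ≠ 0)
    (hlW : l.Coprime (Nat.card W)) (hl3 : ∀ p : ℕ, p.Prime → p ∣ l → p % 3 = 1)
    (hk : k + 1 = l * e) :
    ∃ (G : Type) (_ : Group G) (x y : G), IsAdmissible k 3 G x y := by
  have : NeZero l := ⟨hl⟩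
  obtain ⟨a, ha⟩ := Int.exists_dvd_sq_add_self_add_one hl hl3
  have hr : (a : ZMod l) ^ 2 + a + 1 = 0 := by
    exact_mod_cast (ZMod.intCast_zmod_eq_zero_iff_dvd _ l).2 ha
  generalize (a : ZMod l) = r at hr
  have hr3 : r * r ^ 2 = 1 := by linear_combination (r - 1) * hr
  let ρ : (ZMod l)ˣ := ⟨r, r ^ 2, hr3, by rw [mul_comm, hr3]⟩
  let γ : MulAut (Multiplicative (ZMod l)) := AddEquiv.toMultiplicative (AddAut.mulLeft ρ)
  have hγ : ∀ z : ZMod l, γ (Multiplicative.ofAdd z) = Multiplicative.ofAdd (r * z) :=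
    fun z => rfl
  let α : MulAut (Multiplicative (ZMod l) × W) := MulEquiv.prodCongr γ β
  have hα : ∀ z w, α (z, w) = (γ z, β w) := fun z w => rfl
  have hα3 : α ^ 3 = 1 := by
    refine MulEquiv.ext ?_
    rintro ⟨z, w⟩
    have hz : γ (γ (γ z)) = z := by
      obtain ⟨z, rfl⟩ := Multiplicative.ofAdd.surjective z
      rw [hγ, hγ, hγ, ← mul_assoc, ← mul_assoc, show r * r * r = r * r ^ 2 by ring, hr3, one_mul]
    have hw : β (β (β w)) = w := DFunLike.congr_fun hβ w
    change α (α (α (z, w))) = (z, w)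
    rw [hα, hα, hα, hz, hw]
  have hα1 : α ≠ 1 := by
    intro h
    have h1 : α (1, v) = (1, v) := DFunLike.congr_fun h (1, v)
    rw [hα] at h1
    have h2 : β v = v := congrArg Prod.snd h1
    rw [h2, mul_inv_cancel, orderOf_one] at he
    exact he1 he.symm
  have : Fact (Nat.Prime 3) := ⟨Nat.prime_three⟩
  have hαord : orderOf α = 3 := orderOf_eq_prime hα3 hα1
  let y₀ : Multiplicative (ZMod l) × W := (Multiplicative.ofAdd 1, v)
  let G := (Multiplicative (ZMod l) × W) ⋊[(Subgroup.zpowers α).subtype] (Subgroup.zpowers α)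
  let x : G := SemidirectProduct.inr ⟨α, Subgroup.mem_zpowers α⟩
  let y : G := SemidirectProduct.inl y₀
  have hconj : ∀ n, x * SemidirectProduct.inl n * x⁻¹ = SemidirectProduct.inl (α n) := by
    intro n
    have := SemidirectProduct.inl_aut (φ := (Subgroup.zpowers α).subtype)
      ⟨α, Subgroup.mem_zpowers α⟩ n
    rw [map_inv] at this
    exact this.symm
  refine ⟨G, inferInstance, x, y, ?_, ?_, ?_⟩
  · rw [SemidirectProduct.card, Nat.card_zpowers, hαord, Nat.card_prod, hcard, hk]
    simp
    ring
  · set U := Subgroup.closure {x, y} with hU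
    have hxU : x ∈ U := Subgroup.subset_closure (by simp)
    have hyU : y ∈ U := Subgroup.subset_closure (by simp)
    let V := U.comap (SemidirectProduct.inl : _ →* G)
    have hy₀ : y₀ ∈ V := hyU
    have hαV : ∀ n ∈ V, α n ∈ V := by
      intro n hn
      change SemidirectProduct.inl (α n) ∈ U
      rw [← hconj]
      exact mul_mem (mul_mem hxU hn) (inv_mem hxU)
    have h1V : ((Multiplicative.ofAdd 1, 1) : Multiplicative (ZMod l) × W) ∈ V := by
      -- An exponent that is 1 mod l and 0 mod |W| isolates the first coordinate of y₀.
      obtain ⟨s, hs1, hs2⟩ := Nat.chineseRemainder hlW 1 0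
      have : y₀ ^ s = (Multiplicative.ofAdd 1, 1) := by
        refine Prod.ext ?_ ?_
        · change (Multiplicative.ofAdd (1 : ZMod l)) ^ s = _
          rw [← ofAdd_nsmul, nsmul_one, (ZMod.natCast_eq_natCast_iff s 1 l).2 hs1, Nat.cast_one]
        · change v ^ s = 1
          rw [← orderOf_dvd_iff_pow_eq_one]
          exact (orderOf_dvd_natCard v).trans (Nat.modEq_zero_iff_dvd.1 hs2)
      rw [← this]
      exact pow_mem hy₀ s
    have hzV : ∀ z : Multiplicative (ZMod l), (z, (1 : W)) ∈ V := by
      intro z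
      obtain ⟨z, rfl⟩ := Multiplicative.ofAdd.surjective z
      obtain ⟨j, rfl⟩ := ZMod.intCast_surjective z
      have := zpow_mem h1V j
      rw [Prod.pow_mk, ← ofAdd_zsmul, one_zpow, zsmul_one] at this
      exact this
    have hvV : ((1, v) : Multiplicative (ZMod l) × W) ∈ V := by
      have := mul_mem (inv_mem h1V) hy₀
      simpa [y₀] using this
    have hwV : ∀ w : W, ((1, w) : Multiplicative (ZMod l) × W) ∈ V := by
      intro w
      have hle : Subgroup.closure {v, β v} ≤ V.comap (MonoidHom.inr _ W) := by
        rw [Subgroup.closure_le]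
        rintro w (rfl | rfl)
        · exact hvV
        · have := hαV _ hvV
          rw [hα, map_one] at this
          exact this
      exact hle (hgen ▸ Subgroup.mem_top w)
    have hV : ∀ n, SemidirectProduct.inl n ∈ U := by
      rintro ⟨z, w⟩
      have := mul_mem (hzV z) (hwV w)
      rw [Prod.mk_mul_mk, one_mul, mul_one] at this
      exact this
    rw [eq_top_iff]
    rintro g -
    rw [← SemidirectProduct.inl_left_mul_inr_right g]
    refine mul_mem (hV _) ?_
    obtain ⟨j, hj⟩ := g.right.2
    have hgr : g.right = ⟨α, Subgroup.mem_zpowers α⟩ ^ j := Subtype.ext hj.symm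
    rw [hgr, map_zpow]
    exact zpow_mem hxU j
  · rw [hconj, ← map_inv, ← map_mul, orderOf_injective _ SemidirectProduct.inl_injective]
    have h1 : α y₀ * y₀⁻¹ = (Multiplicative.ofAdd (r - 1), β v * v⁻¹) := by
      change (γ (Multiplicative.ofAdd 1) * (Multiplicative.ofAdd 1)⁻¹, _) = _
      rw [hγ, mul_one, ← ofAdd_neg, ← ofAdd_add, ← sub_eq_add_neg]
      rfl
    have h2 : orderOf (Multiplicative.ofAdd (r - 1)) = l := by
      apply Nat.dvd_antisymm
      · have := orderOf_dvd_natCard (Multiplicative.ofAdd (r - 1))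
        simpa using this
      · set s := orderOf (Multiplicative.ofAdd (r - 1)) with hs
        have h3 : s • (r - 1) = 0 := by
          have := pow_orderOf_eq_one (Multiplicative.ofAdd (r - 1))
          rw [← ofAdd_nsmul, ← ofAdd_zero] at this
          exact Multiplicative.ofAdd.injective this
        -- By r² + r + 1 = 0, (r - 1)(r + 2) = -3, so a multiple that kills r - 1 also kills 3, a
        -- unit mod l.
        have h4 : ((s * 3 : ℕ) : ZMod l) = 0 := by
          rw [nsmul_eq_mul] at h3
          push_cast
          linear_combination (-(r + 2)) * h3 + s * hr
        rw [ZMod.natCast_eq_zero_iff] at h4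
        refine Nat.Coprime.dvd_of_dvd_mul_right ?_ h4
        rw [Nat.coprime_comm, Nat.Prime.coprime_iff_not_dvd Nat.prime_three]
        intro h
        have := hl3 3 Nat.prime_three h
        omega
    rw [h1, Prod.orderOf_mk, h2, he, hk]
    exact Nat.Coprime.lcm_eq_mul (Nat.Coprime.coprime_dvd_right ⟨2, by rw [hcard, mul_comm]⟩ hlW)

/-- An automorphism of order three of the four-group. -/
def kleinAut : MulAut (Multiplicative (ZMod 2) × Multiplicative (ZMod 2)) where
  toFun x := (x.2, x.1 * x.2)
  invFun x := (x.1 * x.2, x.1)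
  left_inv := by decide
  right_inv := by decide
  map_mul' := by decide

/-- The map underlying an automorphism of order three of the quaternion group. -/
def quaternionRotation : QuaternionGroup 2 → QuaternionGroup 2
  | .a i => if i = 0 then .a 0 else if i = 1 then .xa 0 else if i = 2 then .a 2 else .xa 2
  | .xa i => if i = 0 then .xa 3 else if i = 1 then .a 3 else if i = 2 then .xa 1 else .a 1

theorem quaternionRotation_mul (x y : QuaternionGroup 2) :
    quaternionRotation (x * y) = quaternionRotation x * quaternionRotation y := by
  rcases x with i | i <;> rcases y with j | j <;> revert i j <;> decide

theorem quaternionRotation_rotation_rotation (x : QuaternionGroup 2) :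
    quaternionRotation (quaternionRotation (quaternionRotation x)) = x := by
  rcases x with i | i <;> revert i <;> decide

/-- An automorphism of order three of the quaternion group. -/
def quaternionAut : MulAut (QuaternionGroup 2) where
  toFun := quaternionRotation
  invFun x := quaternionRotation (quaternionRotation x)
  left_inv := quaternionRotation_rotation_rotation
  right_inv := quaternionRotation_rotation_rotation
  map_mul' := quaternionRotation_mul

theorem exists_isAdmissible_of_arithCondition {k q : ℕ} (h : ArithCondition k q) :
    ∃ (G : Type u) (_ : Group G) (x y : G), IsAdmissible k q G x y := by
  have key : ∃ (G : Type) (_ : Group G) (x y : G), IsAdmissible k 3 G x y := by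
    have hodd : ∀ l : ℕ, (∀ p : ℕ, p.Prime → p ∣ l → p % 3 = 1) → l.Coprime 2 := by
      intro l hl
      rw [Nat.coprime_comm, Nat.Prime.coprime_iff_not_dvd Nat.prime_two]
      intro h2
      have := hl 2 Nat.prime_two h2
      omega
    rcases h.2 with ⟨hk, hl⟩ | ⟨hk, hl⟩
    · refine exists_isAdmissible_of_mulAut (l := (k + 1) / 2) (e := 2) kleinAut ?_
        (Multiplicative.ofAdd 1, 1) ?_ ?_ (by norm_num) ?_ (by omega) ?_ hl (by omega)
      · exact MulEquiv.ext (by decide)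
      · rw [eq_top_iff]
        rintro x -
        have hx : ∀ x : Multiplicative (ZMod 2) × Multiplicative (ZMod 2), ∃ i j : Fin 2,
            x = (Multiplicative.ofAdd 1, 1) ^ i.1 *
              kleinAut (Multiplicative.ofAdd 1, 1) ^ j.1 := by decide
        obtain ⟨i, j, rfl⟩ := hx x
        exact mul_mem (pow_mem (Subgroup.subset_closure (by simp)) _)
          (pow_mem (Subgroup.subset_closure (by simp)) _)
      · rw [orderOf_eq_prime_iff]
        decide
      · simp
      · rw [Nat.card_prod]
        simp only [Nat.card_eq_fintype_card]
        exact (hodd _ hl).pow_right 2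
    · refine exists_isAdmissible_of_mulAut (l := (k + 1) / 4) (e := 4) quaternionAut ?_
        (.a 1) ?_ ?_ (by norm_num) ?_ (by omega) ?_ hl (by omega)
      · exact MulEquiv.ext quaternionRotation_rotation_rotation
      · rw [eq_top_iff]
        have ha : ∀ i, (.a i : QuaternionGroup 2) ∈
            Subgroup.closure {.a 1, quaternionAut (.a 1)} := by
          intro i
          obtain ⟨j, rfl⟩ := ZMod.natCast_zmod_surjective i
          rw [← QuaternionGroup.a_one_pow]
          exact pow_mem (Subgroup.subset_closure (by simp)) j
        rintro (i | i) -
        · exact ha i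
        · have h0 : (.xa i : QuaternionGroup 2) = quaternionAut (.a 1) * .a i := by
            revert i
            decide
          rw [h0]
          exact mul_mem (Subgroup.subset_closure (by simp)) (ha i)
      · exact QuaternionGroup.orderOf_xa (n := 2) _
      · rw [Nat.card_eq_fintype_card, QuaternionGroup.card]
      · rw [Nat.card_eq_fintype_card, QuaternionGroup.card]
        exact (hodd _ hl).pow_right 3
  obtain ⟨G, _, x, y, hG⟩ := key
  rw [h.1]
  exact ⟨ULift G, inferInstance, _, _, hG.of_mulEquiv MulEquiv.ulift.symm⟩

/-! ### The topology of the surface of an origami -/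

namespace Origami

open unitInterval

variable {S : Type u} (O : Origami S)

/-- The point of the surface with coordinates `(x, y)` in the square `s`. -/
def pt (s : S) (x y : I) : O.Surface := Quot.mk O.Glue ⟨s, (x, y)⟩

theorem pt_one_left (s : S) (y : I) : O.pt s 1 y = O.pt (O.right s) 0 y :=
  Quot.sound (Glue.right s y)

theorem pt_one_right (s : S) (x : I) : O.pt s x 1 = O.pt (O.up s) x 0 :=
  Quot.sound (Glue.up s x)

theorem proj_pt (s : S) (x y : I) :
    O.proj (O.pt s x y) = (((x : ℝ) : UnitAddCircle), ((y : ℝ) : UnitAddCircle)) := rfl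

theorem continuous_pt (s : S) : Continuous fun z : I × I => O.pt s z.1 z.2 := by
  have : Continuous (Quot.mk O.Glue) := continuous_quot_mk
  exact this.comp (@continuous_sigmaMk S (fun _ => I × I) _ s)

theorem exists_pt (P : O.Surface) : ∃ s x y, x ≠ 1 ∧ y ≠ 1 ∧ P = O.pt s x y := by
  obtain ⟨⟨s, x, y⟩, rfl⟩ := Quot.exists_rep P
  have h1 : ∃ s' x', x' ≠ 1 ∧ O.pt s x y = O.pt s' x' y := by
    by_cases hx : x = 1
    · exact ⟨O.right s, 0, zero_ne_one, by rw [hx, pt_one_left]⟩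
    · exact ⟨s, x, hx, rfl⟩
  obtain ⟨s', x', hx', h1⟩ := h1
  by_cases hy : y = 1
  · exact ⟨O.up s', x', 0, hx', zero_ne_one, by rw [← pt_one_right, ← hy]; exact h1⟩
  · exact ⟨s', x', y, hx', hy, h1⟩

theorem coe_circle_eq {x x' : I} (hx : x ≠ 1)
    (h : ((x' : ℝ) : UnitAddCircle) = ((x : ℝ) : UnitAddCircle)) : x' = x ∨ (x' = 1 ∧ x = 0) := by
  have hx1 : (x : ℝ) < 1 := lt_of_le_of_ne x.2.2 fun h => hx (Subtype.ext h)
  have hx0 : (0 : ℝ) ≤ x := x.2.1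
  by_cases hx' : x' = 1
  · subst hx'
    right
    refine ⟨rfl, ?_⟩
    have h0 : ((0 : ℝ) : UnitAddCircle) = ((x : ℝ) : UnitAddCircle) := by
      rw [← h]
      exact (AddCircle.coe_period (1 : ℝ)).symm
    rw [AddCircle.coe_eq_coe_iff_of_mem_Ico (p := (1 : ℝ)) (a := 0) (by simp)
      (by simpa using ⟨hx0, hx1⟩)] at h0
    exact Subtype.ext h0.symm
  · left
    have hx1' : (x' : ℝ) < 1 := lt_of_le_of_ne x'.2.2 fun h => hx' (Subtype.ext h)
    rw [AddCircle.coe_eq_coe_iff_of_mem_Ico (p := (1 : ℝ)) (a := 0)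
      (by simpa using ⟨x'.2.1, hx1'⟩) (by simpa using ⟨hx0, hx1⟩)] at h
    exact Subtype.ext h

/-- The permutation of the squares given by going once around the lower left corner. -/
def vertexPerm : Equiv.Perm S := O.up * O.right * O.up⁻¹ * O.right⁻¹

theorem vertexPerm_right_up (s : S) : O.vertexPerm (O.right (O.up s)) = O.up (O.right s) := by
  simp [vertexPerm]

theorem pt_vertexPerm (s : S) : O.pt (O.vertexPerm s) 0 0 = O.pt s 0 0 := by
  obtain ⟨s, rfl⟩ := O.right.surjective s
  obtain ⟨s, rfl⟩ := O.up.surjective s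
  rw [vertexPerm_right_up, ← pt_one_right, ← pt_one_left, pt_one_right, pt_one_left]

theorem pt_zero_of_sameCycle {s t : S} (h : O.vertexPerm.SameCycle s t) :
    O.pt s 0 0 = O.pt t 0 0 := by
  have hn : ∀ (j : ℕ) (s : S), O.pt ((O.vertexPerm ^ j) s) 0 0 = O.pt s 0 0 := by
    intro j
    induction j with
    | zero => exact fun s => rfl
    | succ j ih =>
      intro s
      rw [pow_succ', Equiv.Perm.mul_apply, pt_vertexPerm, ih]
  obtain ⟨j, rfl⟩ := h
  obtain ⟨j, rfl | rfl⟩ := j.eq_nat_or_neg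
  · rw [zpow_natCast, hn]
  · have h := hn j ((O.vertexPerm ^ j)⁻¹ s)
    rwa [← Equiv.Perm.mul_apply, mul_inv_cancel, Equiv.Perm.one_apply, ← zpow_natCast,
      ← zpow_neg] at h

/-- The function on the surface with prescribed values at the vertices, and bumps with
prescribed heights on the left sides, the lower sides and the squares. -/
noncomputable def bump (w v h a : S → ℝ) (hw : ∀ s, w (O.vertexPerm s) = w s) : O.Surface → ℝ :=
  Quot.lift (fun p =>
      w p.1 * ((1 - (p.2.1 : ℝ)) * (1 - (p.2.2 : ℝ))) +
        w (O.right p.1) * ((p.2.1 : ℝ) * (1 - (p.2.2 : ℝ))) +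
        w (O.up p.1) * ((1 - (p.2.1 : ℝ)) * (p.2.2 : ℝ)) +
        w (O.up (O.right p.1)) * ((p.2.1 : ℝ) * (p.2.2 : ℝ)) +
      (p.2.2 : ℝ) * (1 - (p.2.2 : ℝ)) *
        (v p.1 * (1 - (p.2.1 : ℝ)) + v (O.right p.1) * (p.2.1 : ℝ)) +
      (p.2.1 : ℝ) * (1 - (p.2.1 : ℝ)) *
        (h p.1 * (1 - (p.2.2 : ℝ)) + h (O.up p.1) * (p.2.2 : ℝ)) +
      a p.1 * ((p.2.1 : ℝ) * (1 - (p.2.1 : ℝ)) * ((p.2.2 : ℝ) * (1 - (p.2.2 : ℝ))))) (by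
    intro p p' hp
    cases hp with
    | right s t => simp
    | up s t =>
      have := hw (O.right (O.up s))
      rw [vertexPerm_right_up] at this
      simp [this])

theorem bump_pt (w v h a : S → ℝ) (hw : ∀ s, w (O.vertexPerm s) = w s) (s : S) (x y : I) :
    O.bump w v h a hw (O.pt s x y) =
      w s * ((1 - (x : ℝ)) * (1 - (y : ℝ))) + w (O.right s) * ((x : ℝ) * (1 - (y : ℝ))) +
        w (O.up s) * ((1 - (x : ℝ)) * (y : ℝ)) + w (O.up (O.right s)) * ((x : ℝ) * (y : ℝ)) +
      (y : ℝ) * (1 - (y : ℝ)) * (v s * (1 - (x : ℝ)) + v (O.right s) * (x : ℝ)) +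
      (x : ℝ) * (1 - (x : ℝ)) * (h s * (1 - (y : ℝ)) + h (O.up s) * (y : ℝ)) +
      a s * ((x : ℝ) * (1 - (x : ℝ)) * ((y : ℝ) * (1 - (y : ℝ)))) := rfl

theorem continuous_bump (w v h a : S → ℝ) (hw : ∀ s, w (O.vertexPerm s) = w s) :
    Continuous (O.bump w v h a hw) := by
  refine continuous_quot_lift _ ?_
  rw [continuous_sigma_iff]
  intro s
  fun_prop

theorem continuous_proj : Continuous O.proj := by
  refine continuous_quot_lift _ ?_
  rw [continuous_sigma_iff]
  intro s
  have h : Continuous fun x : ℝ => (x : UnitAddCircle) := AddCircle.continuous_mk' 1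
  exact (h.comp (continuous_subtype_val.comp continuous_fst)).prodMk
    (h.comp (continuous_subtype_val.comp continuous_snd))

open Classical in
/-- A continuous function on the surface that vanishes exactly outside of the interior of the
square `s`. -/
noncomputable def squareBump (s : S) : O.Surface → ℝ :=
  O.bump 0 0 0 (fun t => if t = s then 1 else 0) fun _ => rfl

theorem pos_of_ne_zero {x : I} (h : x ≠ 0) : 0 < (x : ℝ) :=
  unitInterval.pos_iff_ne_zero.2 h

theorem one_sub_pos_of_ne_one {x : I} (h : x ≠ 1) : 0 < 1 - (x : ℝ) :=
  sub_pos.2 (unitInterval.lt_one_iff_ne_one.2 h)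

theorem squareBump_pt_self {s : S} {x y : I} (hx : x ≠ 0) (hx' : x ≠ 1) (hy : y ≠ 0) (hy' : y ≠ 1) :
    O.squareBump s (O.pt s x y) ≠ 0 := by
  have := pos_of_ne_zero hx
  have := pos_of_ne_zero hy
  have := one_sub_pos_of_ne_one hx'
  have := one_sub_pos_of_ne_one hy'
  rw [squareBump, bump_pt]
  simp only [Pi.zero_apply, if_true, zero_mul, add_zero, mul_zero, zero_add, one_mul]
  positivity

theorem squareBump_pt_of_ne {s t : S} (h : t ≠ s) (x y : I) : O.squareBump s (O.pt t x y) = 0 := by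
  rw [squareBump, bump_pt]
  simp [h]

/-- Distinct points of the surface over the same point of the torus are separated by a continuous
real function. The points here are given in distinct squares by the same coordinates. -/
theorem exists_bump_ne {s t : S} {x y : I} (hx : x ≠ 1) (hy : y ≠ 1) (hst : s ≠ t)
    (h0 : x = 0 → y = 0 → ¬ O.vertexPerm.SameCycle s t) :
    ∃ F : O.Surface → ℝ, Continuous F ∧ F (O.pt s x y) ≠ F (O.pt t x y) := by
  classical
  have hx1 := one_sub_pos_of_ne_one hx
  have hy1 := one_sub_pos_of_ne_one hy
  by_cases hx0 : x = 0
  · by_cases hy0 : y = 0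
    · refine ⟨O.bump (fun t => if O.vertexPerm.SameCycle s t then 1 else 0) 0 0 0
        (fun t => by simp only [Equiv.Perm.sameCycle_apply_right]), O.continuous_bump _ _ _ _ _, ?_⟩
      rw [bump_pt, bump_pt, hx0, hy0]
      simp [h0 hx0 hy0, Equiv.Perm.SameCycle.refl]
    · refine ⟨O.bump 0 (fun t => if t = s then 1 else 0) 0 0 (fun _ => rfl),
        O.continuous_bump _ _ _ _ _, ?_⟩
      have := pos_of_ne_zero hy0
      rw [bump_pt, bump_pt, hx0]
      simp [hst.symm]
      exact ⟨hy0, hy1.ne'⟩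
  · by_cases hy0 : y = 0
    · refine ⟨O.bump 0 0 (fun t => if t = s then 1 else 0) 0 (fun _ => rfl),
        O.continuous_bump _ _ _ _ _, ?_⟩
      have := pos_of_ne_zero hx0
      rw [bump_pt, bump_pt, hy0]
      simp [hst.symm]
      exact ⟨hx0, hx1.ne'⟩
    · refine ⟨O.squareBump s, O.continuous_bump _ _ _ _ _, ?_⟩
      rw [O.squareBump_pt_of_ne hst.symm]
      exact O.squareBump_pt_self hx0 hx hy0 hy

theorem pt_injective {s t : S} {x y : I} (hx : x ≠ 1) (hy : y ≠ 1) (h0 : ¬ (x = 0 ∧ y = 0))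
    (h : O.pt s x y = O.pt t x y) : s = t := by
  by_contra hst
  obtain ⟨F, -, hF⟩ := O.exists_bump_ne hx hy hst fun h1 h2 => absurd ⟨h1, h2⟩ h0
  exact hF (congrArg F h)

/-- The indicator function of a cycle of `vertexPerm` extends to a function on the surface that
separates vertices of different cycles. -/
theorem pt_zero_eq_iff {s t : S} : O.pt s 0 0 = O.pt t 0 0 ↔ O.vertexPerm.SameCycle s t := by
  refine ⟨fun h => ?_, O.pt_zero_of_sameCycle⟩
  by_contra hst
  obtain ⟨F, -, hF⟩ := O.exists_bump_ne (s := s) (t := t) zero_ne_one zero_ne_one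
    (fun h => hst (h ▸ Equiv.Perm.SameCycle.refl _ _)) fun _ _ => hst
  exact hF (congrArg F h)

theorem exists_pt_of_proj {P : O.Surface} {x y : I} (hx : x ≠ 1) (hy : y ≠ 1)
    (h : O.proj P = (((x : ℝ) : UnitAddCircle), ((y : ℝ) : UnitAddCircle))) :
    ∃ s, P = O.pt s x y := by
  obtain ⟨s, x', y', hx', hy', rfl⟩ := O.exists_pt P
  rw [proj_pt, Prod.mk.injEq] at h
  rcases coe_circle_eq hx h.1 with rfl | h1
  · rcases coe_circle_eq hy h.2 with rfl | h2
    · exact ⟨s, rfl⟩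
    · exact absurd h2.1 hy'
  · exact absurd h1.1 hx'

instance : T2Space O.Surface := by
  refine ⟨fun P Q hPQ => ?_⟩
  by_cases hproj : O.proj P = O.proj Q
  · obtain ⟨s, x, y, hx, hy, rfl⟩ := O.exists_pt P
    obtain ⟨t, rfl⟩ := O.exists_pt_of_proj hx hy (hproj.symm.trans (O.proj_pt s x y))
    obtain ⟨F, hF, hne⟩ := O.exists_bump_ne hx hy (s := s) (t := t)
      (fun h => hPQ (h ▸ rfl)) (by
        rintro rfl rfl h
        exact hPQ (O.pt_zero_of_sameCycle h))
    exact separated_by_continuous hF hne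
  · exact separated_by_continuous O.continuous_proj hproj

/-- A path in the surface over a path in the open unit square stays in one square. -/
theorem exists_square_of_path (g : ℝ → O.Surface) (ζ : ℝ → I × I) (hg : Continuous g)
    (hζ : Continuous ζ)
    (hint : ∀ r ∈ Set.Ioo (0 : ℝ) 1, (ζ r).1 ≠ 0 ∧ (ζ r).1 ≠ 1 ∧ (ζ r).2 ≠ 0 ∧ (ζ r).2 ≠ 1)
    (hproj : ∀ r ∈ Set.Ioo (0 : ℝ) 1, O.proj (g r) =
      ((((ζ r).1 : ℝ) : UnitAddCircle), (((ζ r).2 : ℝ) : UnitAddCircle))) :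
    ∃ s, ∀ r ∈ Set.Icc (0 : ℝ) 1, g r = O.pt s (ζ r).1 (ζ r).2 := by
  have hex : ∀ r : Set.Ioo (0 : ℝ) 1, ∃ s, g r = O.pt s (ζ r).1 (ζ r).2 := fun r =>
    O.exists_pt_of_proj (hint r r.2).2.1 (hint r r.2).2.2.2 (hproj r r.2)
  choose idx hidx using hex
  -- Nonvanishing of the bump function of a square is an open condition along the path.
  have hconst : IsLocallyConstant idx := by
    rw [IsLocallyConstant.iff_eventually_eq]
    intro r
    have hc : Continuous fun r' : Set.Ioo (0 : ℝ) 1 => O.squareBump (idx r) (g r') :=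
      (O.continuous_bump _ _ _ _ _).comp (hg.comp continuous_subtype_val)
    have hne : O.squareBump (idx r) (g r) ≠ 0 := by
      obtain ⟨h1, h2, h3, h4⟩ := hint r r.2
      have := O.squareBump_pt_self (s := idx r) h1 h2 h3 h4
      rwa [← hidx] at this
    filter_upwards [hc.continuousAt.eventually_ne hne] with r' hr'
    by_contra h
    rw [hidx r'] at hr'
    exact hr' (O.squareBump_pt_of_ne h _ _)
  have : PreconnectedSpace (Set.Ioo (0 : ℝ) 1) :=
    isPreconnected_iff_preconnectedSpace.1 isPreconnected_Ioo
  let r₀ : Set.Ioo (0 : ℝ) 1 := ⟨1 / 2, by norm_num, by norm_num⟩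
  refine ⟨idx r₀, ?_⟩
  -- The end points may lie on sides or corners; they are reached as limits, since the surface is
  -- Hausdorff.
  have hclosed : IsClosed {r : ℝ | g r = O.pt (idx r₀) (ζ r).1 (ζ r).2} :=
    isClosed_eq hg ((O.continuous_pt _).comp hζ)
  have hsub : Set.Ioo (0 : ℝ) 1 ⊆ {r : ℝ | g r = O.pt (idx r₀) (ζ r).1 (ζ r).2} := by
    intro r hr
    have := hidx ⟨r, hr⟩
    rwa [hconst.apply_eq_of_preconnectedSpace ⟨r, hr⟩ r₀] at this
  have := hclosed.closure_subset_iff.2 hsub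
  rw [closure_Ioo zero_ne_one] at this
  exact fun r hr => this hr

end Origami

/-! ### Deck transformations and translations -/

namespace Origami

open unitInterval

variable {S : Type u} (O : Origami S)

/-- The midpoint of the unit interval. -/
noncomputable def half : I := ⟨1 / 2, by norm_num, by norm_num⟩

theorem half_ne_zero : half ≠ 0 := fun h => by
  have := congrArg Subtype.val h
  norm_num [half] at this

theorem half_ne_one : half ≠ 1 := fun h => by
  have := congrArg Subtype.val h
  norm_num [half] at this

theorem pt_half_injective {s t : S} (h : O.pt s half half = O.pt t half half) : s = t :=
  O.pt_injective half_ne_one half_ne_one (fun h => half_ne_zero h.1) h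

/-- The point at time `r` on the segment from the midpoint to `x`. -/
noncomputable def fromHalf (x : I) (r : ℝ) : I :=
  Set.projIcc 0 1 zero_le_one ((1 - r) / 2 + r * x)

theorem continuous_fromHalf (x : I) : Continuous (fromHalf x) := by
  unfold fromHalf
  exact continuous_projIcc.comp (by fun_prop)

theorem coe_fromHalf (x : I) {r : ℝ} (hr : r ∈ Set.Icc (0 : ℝ) 1) :
    (fromHalf x r : ℝ) = (1 - r) / 2 + r * x := by
  unfold fromHalf
  have hx0 := x.2.1
  have hx1 := x.2.2
  have h1 : r * x ≤ r := mul_le_of_le_one_right hr.1 hx1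
  have h0 : 0 ≤ r * x := mul_nonneg hr.1 hx0
  have hmem : (1 - r) / 2 + r * x ∈ Set.Icc (0 : ℝ) 1 := ⟨by linarith [hr.2], by linarith [hr.2]⟩
  rw [Set.projIcc_of_mem zero_le_one hmem]

theorem fromHalf_ne {x : I} {r : ℝ} (hr : r ∈ Set.Ioo (0 : ℝ) 1) :
    fromHalf x r ≠ 0 ∧ fromHalf x r ≠ 1 := by
  have h := coe_fromHalf x (Set.Ioo_subset_Icc_self hr)
  have h1 : r * x ≤ r := mul_le_of_le_one_right hr.1.le x.2.2
  have h0 : 0 ≤ r * x := mul_nonneg hr.1.le x.2.1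
  constructor
  · intro h'
    rw [h', Set.Icc.coe_zero] at h
    linarith [hr.2]
  · intro h'
    rw [h', Set.Icc.coe_one] at h
    linarith [hr.2]

theorem fromHalf_zero (x : I) : fromHalf x 0 = half :=
  Subtype.ext (by rw [coe_fromHalf x (by simp)]; simp [half])

theorem fromHalf_one (x : I) : fromHalf x 1 = x :=
  Subtype.ext (by rw [coe_fromHalf x (by simp)]; simp)

/-- The segment from the midpoint of a square to any of its points is interior to the square before
its end. Its image has the same projection, so it stays in the square determined by the image of the
midpoint. -/
theorem exists_map_of_deck (f : O.Surface → O.Surface) (hf : Continuous f)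
    (hproj : ∀ R, O.proj (f R) = O.proj R) :
    ∃ τ : S → S, ∀ s x y, f (O.pt s x y) = O.pt (τ s) x y := by
  have hpath : ∀ s x y, ∃ t, f (O.pt s half half) = O.pt t half half ∧
      f (O.pt s x y) = O.pt t x y := by
    intro s x y
    have hc : Continuous fun r : ℝ => (fromHalf x r, fromHalf y r) :=
      (continuous_fromHalf x).prodMk (continuous_fromHalf y)
    obtain ⟨t, ht⟩ := O.exists_square_of_path (fun r => f (O.pt s (fromHalf x r) (fromHalf y r)))
      (fun r => (fromHalf x r, fromHalf y r)) (hf.comp ((O.continuous_pt s).comp hc)) hc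
      (fun r hr => ⟨(fromHalf_ne hr).1, (fromHalf_ne hr).2, (fromHalf_ne hr).1, (fromHalf_ne hr).2⟩)
      (fun r _ => by rw [hproj, proj_pt])
    refine ⟨t, ?_, ?_⟩
    · have := ht 0 (by simp)
      simpa only [fromHalf_zero] using this
    · have := ht 1 (by simp)
      simpa only [fromHalf_one] using this
  have hmid : ∀ s, ∃ t, f (O.pt s half half) = O.pt t half half := fun s =>
    ⟨_, (hpath s half half).choose_spec.1⟩
  choose τ hτ using hmid
  refine ⟨τ, fun s x y => ?_⟩
  obtain ⟨t, h1, h2⟩ := hpath s x y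
  rw [hτ] at h1
  rw [h2, O.pt_half_injective h1]

/-- The group of permutations of the squares that are compatible with the side identifications. -/
def autGroup : Subgroup (Equiv.Perm S) := Subgroup.centralizer {O.right, O.up}

variable {O} in
theorem mem_autGroup {τ : Equiv.Perm S} :
    τ ∈ O.autGroup ↔ (∀ s, τ (O.right s) = O.right (τ s)) ∧ ∀ s, τ (O.up s) = O.up (τ s) := by
  rw [autGroup, Subgroup.mem_centralizer_iff]
  constructor
  · intro h
    exact ⟨fun s => (DFunLike.congr_fun (h O.right (by simp)) s).symm,
      fun s => (DFunLike.congr_fun (h O.up (by simp)) s).symm⟩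
  · rintro ⟨h1, h2⟩ g (rfl | rfl)
    · exact Equiv.ext fun s => (h1 s).symm
    · exact Equiv.ext fun s => (h2 s).symm

/-- The map of the surface that moves the square `s` to the square `τ s`. -/
def autMap (τ : O.autGroup) : O.Surface → O.Surface :=
  Quot.map (fun p => ⟨τ.1 p.1, p.2⟩) (by
    intro p p' hp
    obtain ⟨h1, h2⟩ := mem_autGroup.1 τ.2
    cases hp with
    | right s t => exact h1 s ▸ Glue.right (τ.1 s) t
    | up s t => exact h2 s ▸ Glue.up (τ.1 s) t)

theorem continuous_autMap (τ : O.autGroup) : Continuous (O.autMap τ) := by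
  have : Continuous fun p : Squares S => O.pt (τ.1 p.1) p.2.1 p.2.2 :=
    continuous_sigma fun s => O.continuous_pt (τ.1 s)
  exact continuous_quot_lift _ this

/-- The action of the compatible permutations of the squares on the surface. -/
def autHom : O.autGroup →* (O.Surface ≃ₜ O.Surface) where
  toFun τ :=
    { toFun := O.autMap τ
      invFun := O.autMap τ⁻¹
      left_inv := by
        rintro ⟨s, x, y⟩
        change O.pt ((τ⁻¹).1 (τ.1 s)) x y = O.pt s x y
        simp
      right_inv := by
        rintro ⟨s, x, y⟩
        change O.pt (τ.1 ((τ⁻¹).1 s)) x y = O.pt s x y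
        simp
      continuous_toFun := O.continuous_autMap τ
      continuous_invFun := O.continuous_autMap τ⁻¹ }
  map_one' := by
    ext P
    obtain ⟨s, x, y, -, -, rfl⟩ := O.exists_pt P
    rfl
  map_mul' τ τ' := by
    ext P
    obtain ⟨s, x, y, -, -, rfl⟩ := O.exists_pt P
    rfl

theorem autHom_pt (τ : O.autGroup) (s : S) (x y : I) :
    O.autHom τ (O.pt s x y) = O.pt (τ.1 s) x y := rfl

theorem proj_autHom (τ : O.autGroup) (P : O.Surface) : O.proj (O.autHom τ P) = O.proj P := by
  obtain ⟨s, x, y, -, -, rfl⟩ := O.exists_pt P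
  rfl

theorem autHom_injective : Function.Injective O.autHom := by
  intro τ τ' h
  refine Subtype.ext (Equiv.ext fun s => ?_)
  have := DFunLike.congr_fun h (O.pt s half half)
  exact O.pt_half_injective this

theorem exists_autHom_eq_of_deck (f : O.Surface ≃ₜ O.Surface)
    (hproj : ∀ R, O.proj (f R) = O.proj R) : ∃ τ, O.autHom τ = f := by
  obtain ⟨τ, hτ⟩ := O.exists_map_of_deck f f.continuous hproj
  obtain ⟨τ', hτ'⟩ := O.exists_map_of_deck f.symm f.symm.continuous (fun R => by
    rw [← hproj, f.apply_symm_apply])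
  have hl : ∀ s, τ' (τ s) = s := fun s => O.pt_half_injective (by
    rw [← hτ', ← hτ, f.symm_apply_apply])
  have hr : ∀ s, τ (τ' s) = s := fun s => O.pt_half_injective (by
    rw [← hτ, ← hτ', f.apply_symm_apply])
  let e : Equiv.Perm S := ⟨τ, τ', hl, hr⟩
  -- Compatibility with the gluings is tested at midpoints of sides, where the square to the right
  -- or above is unique.
  have he : e ∈ O.autGroup := by
    rw [mem_autGroup]
    constructor
    · intro s
      refine O.pt_injective (x := 0) (y := half) zero_ne_one half_ne_one
        (fun h => half_ne_zero h.2) ?_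
      change O.pt (τ (O.right s)) 0 half = O.pt (O.right (τ s)) 0 half
      rw [← hτ, ← pt_one_left, ← pt_one_left, hτ]
    · intro s
      refine O.pt_injective (x := half) (y := 0) half_ne_one zero_ne_one
        (fun h => half_ne_zero h.1) ?_
      change O.pt (τ (O.up s)) half 0 = O.pt (O.up (τ s)) half 0
      rw [← hτ, ← pt_one_right, ← pt_one_right, hτ]
  refine ⟨⟨e, he⟩, ?_⟩
  ext P
  obtain ⟨s, x, y, -, -, rfl⟩ := O.exists_pt P
  rw [autHom_pt, hτ]
  rfl

/-- Each square is connected, and `right` and `up` link all squares. -/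
theorem exists_const_of_isLocallyConstant {A : Type*} {g : O.Surface → A}
    (hg : IsLocallyConstant g) : ∃ a, ∀ P, g P = a := by
  have hsq : ∀ s x y x' y', g (O.pt s x y) = g (O.pt s x' y') := fun s x y x' y' =>
    (hg.comp_continuous (O.continuous_pt s)).apply_eq_of_preconnectedSpace (x, y) (x', y')
  obtain ⟨s₀⟩ := O.nonempty
  refine ⟨g (O.pt s₀ 0 0), fun P => ?_⟩
  obtain ⟨t, x, y, -, -, rfl⟩ := O.exists_pt P
  obtain ⟨γ, hγ, rfl⟩ := O.connected s₀ t
  rw [hsq _ x y 0 0]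
  have key : ∀ s, g (O.pt (γ s) 0 0) = g (O.pt s 0 0) := by
    induction hγ using Subgroup.closure_induction with
    | mem γ h =>
      intro s
      rcases h with rfl | rfl
      · rw [← pt_one_left, hsq _ 1 0 0 0]
      · rw [← pt_one_right, hsq _ 0 1 0 0]
    | one => exact fun s => rfl
    | mul γ γ' _ _ h h' =>
      intro s
      rw [Equiv.Perm.mul_apply, h, h']
    | inv γ _ h =>
      intro s
      rw [← h, ← Equiv.Perm.mul_apply, mul_inv_cancel, Equiv.Perm.one_apply]
  exact key s₀

/-- The point `c + r * δ` of the unit interval. -/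
noncomputable def diag (c δ r : ℝ) : I := Set.projIcc 0 1 zero_le_one (c + r * δ)

theorem continuous_diag (c δ : ℝ) : Continuous (diag c δ) := by
  unfold diag
  exact continuous_projIcc.comp (by fun_prop)

theorem coe_diag {c δ r : ℝ} (hc : 0 ≤ c) (hδ : 0 ≤ δ) (hcδ : c + δ ≤ 1)
    (hr : r ∈ Set.Icc (0 : ℝ) 1) : (diag c δ r : ℝ) = c + r * δ := by
  have h1 : r * δ ≤ δ := mul_le_of_le_one_left hδ hr.2
  have h0 : 0 ≤ r * δ := mul_nonneg hr.1 hδ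
  unfold diag
  rw [Set.projIcc_of_mem zero_le_one ⟨by linarith, by linarith⟩]

theorem diag_ne {c δ r : ℝ} (hc : 0 ≤ c) (hδ : 0 < δ) (hcδ : c + δ ≤ 1)
    (hr : r ∈ Set.Ioo (0 : ℝ) 1) : diag c δ r ≠ 0 ∧ diag c δ r ≠ 1 := by
  have h := coe_diag hc hδ.le hcδ (Set.Ioo_subset_Icc_self hr)
  have h1 : r * δ < δ := mul_lt_of_lt_one_left hδ hr.2
  have h0 : 0 < r * δ := mul_pos hr.1 hδ
  constructor
  · intro h'
    rw [h', Set.Icc.coe_zero] at h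
    linarith
  · intro h'
    rw [h', Set.Icc.coe_one] at h
    linarith

/-- If several squares meet at a vertex with their lower left corners, then the translations
of the origami are deck transformations. -/
theorem proj_eq_of_mem_trans {s s' : S} (hss' : s ≠ s') (hpt : O.pt s 0 0 = O.pt s' 0 0)
    {f : O.Surface ≃ₜ O.Surface} (hf : f ∈ O.trans) (R : O.Surface) : O.proj (f R) = O.proj R := by
  have hf' : IsLocallyConstant fun P => O.proj (f P) - O.proj P := hf
  obtain ⟨a, ha⟩ := O.exists_const_of_isLocallyConstant hf'
  obtain ⟨t₀, x, y, hx, hy, hP⟩ := O.exists_pt (f (O.pt s 0 0))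
  have haxy : a = (((x : ℝ) : UnitAddCircle), ((y : ℝ) : UnitAddCircle)) := by
    rw [← ha (O.pt s 0 0), hP, proj_pt, proj_pt]
    simp
  -- If the vertex goes to a vertex, the constant translation vector a is zero.
  by_cases hxy : x = 0 ∧ y = 0
  · rw [hxy.1, hxy.2] at haxy
    have : a = 0 := by
      rw [haxy]
      simp
    rw [← sub_eq_zero, ha R, this]
  -- Otherwise the image of the vertex has a single square to its upper right. The diagonals of s
  -- and s' issuing from the vertex then have the same image, against injectivity of f.
  exfalso
  have hx1 := one_sub_pos_of_ne_one hx
  have hy1 := one_sub_pos_of_ne_one hy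
  obtain ⟨δ, hδ, hδx, hδy⟩ : ∃ δ : ℝ, 0 < δ ∧ (x : ℝ) + δ ≤ 1 ∧ (y : ℝ) + δ ≤ 1 :=
    ⟨min (1 - x) (1 - y), lt_min hx1 hy1, by linarith [min_le_left (1 - (x : ℝ)) (1 - y)],
      by linarith [min_le_right (1 - (x : ℝ)) (1 - y)]⟩
  have hx0 : (0 : ℝ) ≤ x := x.2.1
  have hy0 : (0 : ℝ) ≤ y := y.2.1
  have hδ1 : 0 + δ ≤ 1 := by linarith
  have hpath : ∀ w : S, ∃ t, f (O.pt w 0 0) = O.pt t x y ∧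
      f (O.pt w (diag 0 δ (1 / 2)) (diag 0 δ (1 / 2))) =
        O.pt t (diag x δ (1 / 2)) (diag y δ (1 / 2)) := by
    intro w
    obtain ⟨t, ht⟩ := O.exists_square_of_path (fun r => f (O.pt w (diag 0 δ r) (diag 0 δ r)))
      (fun r => (diag x δ r, diag y δ r))
      (f.continuous.comp ((O.continuous_pt w).comp
        ((continuous_diag 0 δ).prodMk (continuous_diag 0 δ))))
      ((continuous_diag x δ).prodMk (continuous_diag y δ))
      (fun r hr => ⟨(diag_ne hx0 hδ hδx hr).1, (diag_ne hx0 hδ hδx hr).2,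
        (diag_ne hy0 hδ hδy hr).1, (diag_ne hy0 hδ hδy hr).2⟩)
      (fun r hr => by
        have hr' := Set.Ioo_subset_Icc_self hr
        rw [← sub_add_cancel (O.proj _) (O.proj (O.pt w (diag 0 δ r) (diag 0 δ r))), ha, haxy,
          proj_pt, coe_diag le_rfl hδ.le hδ1 hr', coe_diag hx0 hδ.le hδx hr',
          coe_diag hy0 hδ.le hδy hr', Prod.mk_add_mk, ← AddCircle.coe_add, ← AddCircle.coe_add,
          zero_add])
    have hd0 : ∀ c : I, (c : ℝ) + δ ≤ 1 → diag c δ 0 = c := fun c hc => Subtype.ext (by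
      rw [coe_diag c.2.1 hδ.le hc (by simp)]
      simp)
    refine ⟨t, ?_, ht (1 / 2) (by norm_num)⟩
    have := ht 0 (by simp)
    have h00 : diag 0 δ 0 = 0 := hd0 0 (by simpa using hδ1)
    simpa only [h00, hd0 x hδx, hd0 y hδy] using this
  obtain ⟨t, h1, h2⟩ := hpath s
  obtain ⟨t', h1', h2'⟩ := hpath s'
  rw [hpt, h1'] at h1
  have htt : t' = t := O.pt_injective hx hy hxy h1
  rw [htt, ← h2] at h2'
  have h3 := f.injective h2'
  have hd := diag_ne le_rfl hδ hδ1 (r := 1 / 2) (by norm_num)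
  exact hss' (O.pt_injective hd.2 hd.2 (fun h => hd.1 h.1) h3).symm

theorem nonempty_autGroup_mulEquiv_trans {s s' : S} (hss' : s ≠ s')
    (hpt : O.pt s 0 0 = O.pt s' 0 0) : Nonempty (O.autGroup ≃* O.trans) := by
  have h : O.autHom.range = O.trans := by
    ext f
    constructor
    · rintro ⟨τ, rfl⟩
      have : (fun P => O.proj (O.autHom τ P) - O.proj P) = fun _ => 0 := by
        funext P
        rw [proj_autHom, sub_self]
      change IsLocallyConstant _
      rw [this]
      exact IsLocallyConstant.const 0
    · intro hf
      exact O.exists_autHom_eq_of_deck f (O.proj_eq_of_mem_trans hss' hpt hf)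
  exact ⟨(MonoidHom.ofInjective O.autHom_injective).trans (MulEquiv.subgroupCongr h)⟩

theorem isRegular_iff : O.IsRegular ↔ ∀ s t : S, ∃ τ ∈ O.autGroup, τ s = t := by
  constructor
  · intro h s t
    obtain ⟨f, hf, hst⟩ := h (O.pt s half half) (O.pt t half half) rfl
    obtain ⟨τ, rfl⟩ := O.exists_autHom_eq_of_deck f hf
    exact ⟨τ.1, τ.2, O.pt_half_injective hst⟩
  · intro h P Q hPQ
    obtain ⟨s, x, y, hx, hy, rfl⟩ := O.exists_pt P
    obtain ⟨t, rfl⟩ := O.exists_pt_of_proj hx hy (hPQ.symm.trans (O.proj_pt s x y))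
    obtain ⟨τ, hτ, rfl⟩ := h s t
    exact ⟨O.autHom ⟨τ, hτ⟩, O.proj_autHom _, rfl⟩

end Origami

/-! ### Cone angles and strata -/

namespace Origami

open unitInterval

variable {S : Type u} (O : Origami S)

theorem squareAngle_corner {x y : I} (hx : x = 0 ∨ x = 1) (hy : y = 0 ∨ y = 1) :
    squareAngle (x, y) = Real.pi / 2 := by
  unfold squareAngle
  rw [if_pos hx, if_pos hy]
  ring

theorem squareAngle_side_left {x y : I} (hx : x = 0 ∨ x = 1) (hy : ¬ (y = 0 ∨ y = 1)) :
    squareAngle (x, y) = Real.pi := by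
  unfold squareAngle
  rw [if_pos hx, if_neg hy]
  ring

theorem squareAngle_side_right {x y : I} (hx : ¬ (x = 0 ∨ x = 1)) (hy : y = 0 ∨ y = 1) :
    squareAngle (x, y) = Real.pi := by
  unfold squareAngle
  rw [if_neg hx, if_pos hy]
  ring

theorem squareAngle_interior {x y : I} (hx : ¬ (x = 0 ∨ x = 1)) (hy : ¬ (y = 0 ∨ y = 1)) :
    squareAngle (x, y) = 2 * Real.pi := by
  unfold squareAngle
  rw [if_neg hx, if_neg hy]
  ring

theorem coords_of_pt_eq {s t : S} {x y x' y' : I} (hx : x ≠ 1) (hy : y ≠ 1)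
    (h : O.pt t x' y' = O.pt s x y) :
    (x' = x ∨ (x' = 1 ∧ x = 0)) ∧ (y' = y ∨ (y' = 1 ∧ y = 0)) := by
  have h1 := congrArg O.proj h
  rw [proj_pt, proj_pt, Prod.mk.injEq] at h1
  exact ⟨coe_circle_eq hx h1.1, coe_circle_eq hy h1.2⟩

theorem coneAngle_pt_of_ne_zero {s : S} {x y : I} (hx : x ≠ 1) (hy : y ≠ 1)
    (h0 : ¬ (x = 0 ∧ y = 0)) : O.coneAngle (O.pt s x y) = 2 * Real.pi := by
  unfold coneAngle
  by_cases hx0 : x = 0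
  · subst hx0
    have hy0 : y ≠ 0 := fun h => h0 ⟨rfl, h⟩
    have hset : {a : Squares S | Quot.mk O.Glue a = O.pt s 0 y} =
        {⟨s, (0, y)⟩, ⟨O.right⁻¹ s, (1, y)⟩} := by
      ext ⟨t, x', y'⟩
      rw [Set.mem_insert_iff, Set.mem_singleton_iff]
      change O.pt t x' y' = O.pt s 0 y ↔ _
      constructor
      · intro h
        obtain ⟨h1, h2⟩ := O.coords_of_pt_eq hx hy h
        obtain rfl : y' = y := h2.resolve_right fun h => hy0 h.2
        rcases h1 with rfl | ⟨rfl, -⟩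
        · left
          rw [O.pt_injective hx hy h0 h]
        · right
          rw [pt_one_left] at h
          rw [← O.pt_injective hx hy h0 h]
          simp
      · rintro (h | h)
        · cases h
          rfl
        · cases h
          rw [pt_one_left]
          simp
    rw [hset, finsum_mem_pair (by simp),
      squareAngle_side_left (Or.inl rfl) (not_or.2 ⟨hy0, hy⟩),
      squareAngle_side_left (Or.inr rfl) (not_or.2 ⟨hy0, hy⟩)]
    ring
  · by_cases hy0 : y = 0
    · subst hy0
      have hset : {a : Squares S | Quot.mk O.Glue a = O.pt s x 0} =
          {⟨s, (x, 0)⟩, ⟨O.up⁻¹ s, (x, 1)⟩} := by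
        ext ⟨t, x', y'⟩
        rw [Set.mem_insert_iff, Set.mem_singleton_iff]
        change O.pt t x' y' = O.pt s x 0 ↔ _
        constructor
        · intro h
          obtain ⟨h1, h2⟩ := O.coords_of_pt_eq hx hy h
          obtain rfl : x' = x := h1.resolve_right fun h => hx0 h.2
          rcases h2 with rfl | ⟨rfl, -⟩
          · left
            rw [O.pt_injective hx hy h0 h]
          · right
            rw [pt_one_right] at h
            rw [← O.pt_injective hx hy h0 h]
            simp
        · rintro (h | h)
          · cases h
            rfl
          · cases h
            rw [pt_one_right]
            simp
      rw [hset, finsum_mem_pair (by simp),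
        squareAngle_side_right (not_or.2 ⟨hx0, hx⟩) (Or.inl rfl),
        squareAngle_side_right (not_or.2 ⟨hx0, hx⟩) (Or.inr rfl)]
      ring
    · have hset : {a : Squares S | Quot.mk O.Glue a = O.pt s x y} = {⟨s, (x, y)⟩} := by
        ext ⟨t, x', y'⟩
        rw [Set.mem_singleton_iff]
        change O.pt t x' y' = O.pt s x y ↔ _
        constructor
        · intro h
          obtain ⟨h1, h2⟩ := O.coords_of_pt_eq hx hy h
          obtain rfl : x' = x := h1.resolve_right fun h => hx0 h.2
          obtain rfl : y' = y := h2.resolve_right fun h => hy0 h.2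
          rw [O.pt_injective hx hy h0 h]
        · intro h
          cases h
          rfl
      rw [hset, finsum_mem_singleton,
        squareAngle_interior (not_or.2 ⟨hx0, hx⟩) (not_or.2 ⟨hy0, hy⟩)]

/-- The corner of a square that lies at the lower left corner of the square `t`: the lower or upper,
left or right corner according to the Boolean values. -/
def corner (p : S × Bool × Bool) : Squares S :=
  match p with
  | (t, false, false) => ⟨t, (0, 0)⟩
  | (t, true, false) => ⟨O.right⁻¹ t, (1, 0)⟩
  | (t, false, true) => ⟨O.up⁻¹ t, (0, 1)⟩
  | (t, true, true) => ⟨O.right⁻¹ (O.up⁻¹ t), (1, 1)⟩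

theorem mk_corner (t : S) (b : Bool × Bool) : Quot.mk O.Glue (O.corner (t, b)) = O.pt t 0 0 := by
  obtain ⟨b, b'⟩ := b
  cases b <;> cases b'
  · rfl
  · change O.pt (O.up⁻¹ t) 0 1 = _
    rw [pt_one_right]
    simp
  · change O.pt (O.right⁻¹ t) 1 0 = _
    rw [pt_one_left]
    simp
  · change O.pt (O.right⁻¹ (O.up⁻¹ t)) 1 1 = _
    rw [pt_one_left, pt_one_right]
    simp

theorem corner_injective : Function.Injective O.corner := by
  rintro ⟨t, b, b'⟩ ⟨t', c, c'⟩ h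
  cases b <;> cases b' <;> cases c <;> cases c' <;> simp_all [corner]

theorem exists_corner_eq {t : S} {x y : I} (hx : x = 0 ∨ x = 1) (hy : y = 0 ∨ y = 1) :
    ∃ p, O.corner p = ⟨t, (x, y)⟩ := by
  rcases hx with rfl | rfl <;> rcases hy with rfl | rfl
  · exact ⟨(t, false, false), rfl⟩
  · exact ⟨(O.up t, false, true), by simp [corner]⟩
  · exact ⟨(O.right t, true, false), by simp [corner]⟩
  · exact ⟨(O.up (O.right t), true, true), by simp [corner]⟩

/-- Each square with its lower left corner at the vertex accounts, through `corner`, for four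
corners of angle π/2. -/
theorem coneAngle_vertex [Finite S] (s : S) :
    O.coneAngle (O.pt s 0 0) = 2 * Real.pi * {t | O.pt t 0 0 = O.pt s 0 0}.ncard := by
  have hset : {a : Squares S | Quot.mk O.Glue a = O.pt s 0 0} =
      O.corner '' ({t | O.pt t 0 0 = O.pt s 0 0} ×ˢ Set.univ) := by
    ext ⟨t, x, y⟩
    constructor
    · intro h
      have h' : O.pt t x y = O.pt s 0 0 := h
      obtain ⟨h1, h2⟩ := O.coords_of_pt_eq zero_ne_one zero_ne_one h'
      obtain ⟨⟨t', b⟩, hp⟩ := O.exists_corner_eq (t := t) (x := x) (y := y)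
        (h1.imp_right And.left) (h2.imp_right And.left)
      refine ⟨(t', b), ⟨?_, Set.mem_univ _⟩, hp⟩
      change O.pt t' 0 0 = _
      rw [← O.mk_corner t' b, hp]
      exact h
    · rintro ⟨⟨t', b⟩, ⟨h1, -⟩, hp⟩
      change Quot.mk O.Glue _ = _
      rw [← hp, mk_corner]
      exact h1
  have hfin : {a : Squares S | Quot.mk O.Glue a = O.pt s 0 0}.Finite := by
    rw [hset]
    exact (Set.toFinite _).image _
  have hangle : ∀ a ∈ hfin.toFinset, squareAngle a.2 = Real.pi / 2 := by
    rintro ⟨t, x, y⟩ h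
    rw [Set.Finite.mem_toFinset] at h
    have h' : O.pt t x y = O.pt s 0 0 := h
    obtain ⟨h1, h2⟩ := O.coords_of_pt_eq zero_ne_one zero_ne_one h'
    exact squareAngle_corner (h1.imp_right And.left) (h2.imp_right And.left)
  unfold coneAngle
  rw [finsum_mem_eq_finite_toFinset_sum _ hfin, Finset.sum_congr rfl hangle, Finset.sum_const,
    ← Set.ncard_eq_toFinset_card _ hfin, hset, Set.ncard_image_of_injective _ O.corner_injective,
    Set.ncard_prod, Set.ncard_univ]
  simp
  ring

theorem hasOrder_vertex_iff [Finite S] (s : S) (m : ℕ) :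
    O.HasOrder (O.pt s 0 0) m ↔ {t | O.pt t 0 0 = O.pt s 0 0}.ncard = m + 1 := by
  unfold HasOrder
  rw [coneAngle_vertex, mul_right_inj' (by positivity)]
  exact_mod_cast Iff.rfl

theorem exists_vertex_of_not_hasOrder_zero {P : O.Surface} (h : ¬ O.HasOrder P 0) :
    ∃ s, P = O.pt s 0 0 := by
  obtain ⟨s, x, y, hx, hy, rfl⟩ := O.exists_pt P
  by_cases h0 : x = 0 ∧ y = 0
  · obtain ⟨rfl, rfl⟩ := h0
    exact ⟨s, rfl⟩
  · refine absurd ?_ h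
    unfold HasOrder
    rw [O.coneAngle_pt_of_ne_zero hx hy h0]
    simp

variable {O} in
/-- If all vertices have the same number `n` of lower left corners, then the origami lies in the
stratum `H(k ^ r)`, where `r > 0` and `k > 0`, if and only if `n = k + 1` and there are
`r * (k + 1)` squares. -/
theorem inStratum_iff_of_ncard [Finite S] {n k r : ℕ} (hk : k ≠ 0) (hr : r ≠ 0)
    (hn : ∀ s, {t | O.pt t 0 0 = O.pt s 0 0}.ncard = n) :
    O.InStratum k r ↔ n = k + 1 ∧ Nat.card S = r * (k + 1) := by
  have hcount : Nat.card S = (Set.range fun s => O.pt s 0 0).ncard * n := by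
    classical
    have := Fintype.ofFinite S
    have hfin := Set.finite_range fun s => O.pt s 0 0
    rw [Set.ncard_eq_toFinset_card _ hfin, Nat.card_eq_fintype_card, ← Finset.card_univ,
      Finset.card_eq_sum_card_fiberwise (f := fun s => O.pt s 0 0) (t := hfin.toFinset)
        (fun s _ => by simp), Finset.sum_const_nat]
    intro P hP
    rw [Set.Finite.mem_toFinset] at hP
    obtain ⟨s, rfl⟩ := hP
    rw [← hn s, Set.ncard_eq_toFinset_card']
    congr 1
    ext t
    simp
  -- For n = 1 the differential has no zeros; otherwise its zeros are exactly the vertices.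
  have hzero : n ≠ 1 → {P : O.Surface | ¬ O.HasOrder P 0} = Set.range fun s => O.pt s 0 0 := by
    intro h1
    ext P
    constructor
    · intro h
      obtain ⟨s, rfl⟩ := O.exists_vertex_of_not_hasOrder_zero h
      exact ⟨s, rfl⟩
    · rintro ⟨s, rfl⟩ h
      rw [hasOrder_vertex_iff, hn] at h
      exact h1 h
  constructor
  · rintro ⟨-, hcard, hord⟩
    have hne : {P : O.Surface | ¬ O.HasOrder P 0}.Nonempty := by
      rw [Set.nonempty_iff_ne_empty]
      intro h
      rw [h, Set.ncard_empty] at hcard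
      exact hr hcard.symm
    obtain ⟨P, hP⟩ := hne
    have hPk := hord P hP
    obtain ⟨s, rfl⟩ := O.exists_vertex_of_not_hasOrder_zero hP
    rw [hasOrder_vertex_iff, hn] at hPk
    refine ⟨hPk, ?_⟩
    rw [hzero (by omega)] at hcard
    rw [hcount, hcard, hPk]
  · rintro ⟨rfl, hS⟩
    have hz := hzero (by omega)
    refine ⟨?_, ?_, ?_⟩
    · rw [hz]
      exact Set.finite_range _
    · rw [hz]
      rw [hcount] at hS
      exact Nat.eq_of_mul_eq_mul_right (Nat.succ_pos k) hS
    · intro P hP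
      obtain ⟨s, rfl⟩ := O.exists_vertex_of_not_hasOrder_zero hP
      rw [hasOrder_vertex_iff, hn]

/-! ### Regular origamis and groups with two generators -/

section Cayley

variable {G : Type*} [Group G] {x y : G} (e : G ≃ S)

variable {O} in
theorem ncard_vertex_of_cayley (hx : ∀ g, O.right (e g) = e (g * x))
    (hy : ∀ g, O.up (e g) = e (g * y)) (s : S) :
    {t | O.pt t 0 0 = O.pt s 0 0}.ncard = orderOf (x * y * x⁻¹ * y⁻¹) := by
  have hx' : ∀ g, O.right⁻¹ (e g) = e (g * x⁻¹) := by
    intro g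
    rw [Equiv.Perm.inv_eq_iff_eq, hx, inv_mul_cancel_right]
  have hy' : ∀ g, O.up⁻¹ (e g) = e (g * y⁻¹) := by
    intro g
    rw [Equiv.Perm.inv_eq_iff_eq, hy, inv_mul_cancel_right]
  -- Permutations compose in the order opposite to right multiplications, so `vertexPerm` becomes
  -- multiplication by this conjugate of the commutator.
  set d := x⁻¹ * y⁻¹ * x * y with hd
  have hκ : ∀ g, O.vertexPerm (e g) = e (g * d) := by
    intro g
    simp only [vertexPerm, Equiv.Perm.mul_apply, hx', hy', hx, hy, hd, mul_assoc]
  have hpow : ∀ (j : ℕ) g, (O.vertexPerm ^ j) (e g) = e (g * d ^ j) := by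
    intro j
    induction j with
    | zero => simp
    | succ j ih =>
      intro g
      rw [pow_succ', Equiv.Perm.mul_apply, ih, hκ, mul_assoc, ← pow_succ]
  have hzpow : ∀ (j : ℤ) g, (O.vertexPerm ^ j) (e g) = e (g * d ^ j) := by
    intro j g
    obtain ⟨j, rfl | rfl⟩ := j.eq_nat_or_neg
    · rw [zpow_natCast, zpow_natCast, hpow]
    · rw [zpow_neg, zpow_natCast, zpow_neg, zpow_natCast, Equiv.Perm.inv_eq_iff_eq, hpow,
        inv_mul_cancel_right]
  obtain ⟨g, rfl⟩ := e.surjective s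
  have hset : {t | O.pt t 0 0 = O.pt (e g) 0 0} =
      (fun h => e (g * h)) '' (Subgroup.zpowers d : Set G) := by
    ext t
    rw [Set.mem_ofPred_eq, eq_comm, pt_zero_eq_iff]
    constructor
    · rintro ⟨j, rfl⟩
      exact ⟨d ^ j, ⟨j, rfl⟩, (hzpow j g).symm⟩
    · rintro ⟨_, ⟨j, rfl⟩, rfl⟩
      exact ⟨j, hzpow j g⟩
  have hord : orderOf d = orderOf (x * y * x⁻¹ * y⁻¹) := by
    have : d = MulAut.conj (y * x)⁻¹ (x * y * x⁻¹ * y⁻¹) := by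
      rw [hd, MulAut.conj_apply]
      group
    rw [this]
    exact MulEquiv.orderOf_eq _ _
  rw [hset, Set.ncard_image_of_injective _ fun a b h => mul_left_cancel (e.injective h), ← hord,
    ← Nat.card_zpowers]
  rfl

end Cayley

/-- The origami whose squares are the elements of a group with generators `x` and `y`. -/
def ofGroup {G : Type u} [Group G] (x y : G) (h : Subgroup.closure {x, y} = ⊤) : Origami G where
  right := Equiv.mulRight x
  up := Equiv.mulRight y
  nonempty := ⟨1⟩
  connected := by
    have key : ∀ g : G, ∀ s : G,
        ∃ γ ∈ Subgroup.closure {Equiv.mulRight x, Equiv.mulRight y}, γ s = s * g := by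
      intro g
      have hg : g ∈ Subgroup.closure {x, y} := h ▸ Subgroup.mem_top g
      induction hg using Subgroup.closure_induction with
      | mem g hg =>
        intro s
        rcases hg with rfl | rfl
        · exact ⟨Equiv.mulRight g, Subgroup.subset_closure (by simp), rfl⟩
        · exact ⟨Equiv.mulRight g, Subgroup.subset_closure (by simp), rfl⟩
      | one => exact fun s => ⟨1, one_mem _, (mul_one s).symm⟩
      | mul a b _ _ ha hb =>
        intro s
        obtain ⟨γ, hγ, h1⟩ := ha s
        obtain ⟨γ', hγ', h2⟩ := hb (s * a)
        exact ⟨γ' * γ, mul_mem hγ' hγ, by rw [Equiv.Perm.mul_apply, h1, h2, mul_assoc]⟩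
      | inv a _ ha =>
        intro s
        obtain ⟨γ, hγ, h1⟩ := ha (s * a⁻¹)
        refine ⟨γ⁻¹, inv_mem hγ, ?_⟩
        rw [Equiv.Perm.inv_eq_iff_eq, h1, inv_mul_cancel_right]
    intro s t
    obtain ⟨γ, hγ, h1⟩ := key (s⁻¹ * t) s
    exact ⟨γ, hγ, by rw [h1, mul_inv_cancel_left]⟩

theorem isRegular_ofGroup {G : Type u} [Group G] (x y : G) (h : Subgroup.closure {x, y} = ⊤) :
    (ofGroup x y h).IsRegular := by
  rw [isRegular_iff]
  intro s t
  refine ⟨Equiv.mulLeft (t * s⁻¹), ?_, ?_⟩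
  · rw [mem_autGroup]
    exact ⟨fun g => (mul_assoc _ _ _).symm, fun g => (mul_assoc _ _ _).symm⟩
  · simp

theorem inStratum_ofGroup {k q : ℕ} (hk : k ≠ 0) (hq : q ≠ 0) {G : Type u} [Group G] {x y : G}
    (h : IsAdmissible k q G x y) : (ofGroup x y h.2.1).InStratum k (2 * q) := by
  have : Finite G := Nat.finite_of_card_ne_zero (by rw [h.1]; positivity)
  rw [inStratum_iff_of_ncard hk (by omega) (n := k + 1)]
  · refine ⟨rfl, ?_⟩
    rw [h.1]
    ring
  · intro s
    rw [ncard_vertex_of_cayley (x := x) (y := y) (Equiv.refl G) (fun g => rfl) (fun g => rfl), h.2.2]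

/-- The group of compatible permutations of the squares of a regular origami is generated by two
elements that correspond to the two neighbours of a square. -/
theorem exists_cayley_of_isRegular (hO : O.IsRegular) :
    ∃ (x y : O.autGroup) (e : O.autGroup ≃ S), (∀ g, O.right (e g) = e (g * x)) ∧
      (∀ g, O.up (e g) = e (g * y)) ∧ Subgroup.closure {x, y} = ⊤ := by
  rw [isRegular_iff] at hO
  obtain ⟨s₀⟩ := O.nonempty
  have hcomm : ∀ (τ : O.autGroup), ∀ γ ∈ Subgroup.closure {O.right, O.up}, ∀ s,
      τ.1 (γ s) = γ (τ.1 s) := by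
    intro τ γ hγ
    induction hγ using Subgroup.closure_induction with
    | mem γ h =>
      rcases h with rfl | rfl
      · exact (mem_autGroup.1 τ.2).1
      · exact (mem_autGroup.1 τ.2).2
    | one => exact fun s => rfl
    | mul γ γ' _ _ h h' =>
      intro s
      rw [Equiv.Perm.mul_apply, Equiv.Perm.mul_apply, h, h']
    | inv γ _ h =>
      intro s
      rw [eq_comm, Equiv.Perm.inv_eq_iff_eq, ← h, ← Equiv.Perm.mul_apply γ, mul_inv_cancel,
        Equiv.Perm.one_apply]
  -- An automorphism commutes with the transitive group generated by `right` and `up`, so the image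
  -- of s₀ determines it; regularity gives surjectivity.
  have hbij : Function.Bijective fun τ : O.autGroup => τ.1 s₀ := by
    constructor
    · intro τ τ' h
      refine Subtype.ext (Equiv.ext fun s => ?_)
      obtain ⟨γ, hγ, rfl⟩ := O.connected s₀ s
      rw [hcomm τ γ hγ, hcomm τ' γ hγ]
      exact congrArg γ h
    · intro s
      obtain ⟨τ, hτ, h⟩ := hO s₀ s
      exact ⟨⟨τ, hτ⟩, h⟩
  let e : O.autGroup ≃ S := Equiv.ofBijective _ hbij
  have he : ∀ τ, e τ = τ.1 s₀ := fun τ => rfl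
  obtain ⟨x, hx⟩ := e.surjective (O.right s₀)
  obtain ⟨y, hy⟩ := e.surjective (O.up s₀)
  have hright : ∀ g, O.right (e g) = e (g * x) := by
    intro g
    change O.right (g.1 s₀) = g.1 (e x)
    rw [hx, (mem_autGroup.1 g.2).1]
  have hup : ∀ g, O.up (e g) = e (g * y) := by
    intro g
    change O.up (g.1 s₀) = g.1 (e y)
    rw [hy, (mem_autGroup.1 g.2).2]
  refine ⟨x, y, e, hright, hup, ?_⟩
  have key : ∀ γ ∈ Subgroup.closure {O.right, O.up}, ∀ g,
      ∃ h ∈ Subgroup.closure {x, y}, γ (e g) = e (g * h) := by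
    intro γ hγ
    induction hγ using Subgroup.closure_induction with
    | mem γ h =>
      intro g
      rcases h with rfl | rfl
      · exact ⟨x, Subgroup.subset_closure (by simp), hright g⟩
      · exact ⟨y, Subgroup.subset_closure (by simp), hup g⟩
    | one => exact fun g => ⟨1, one_mem _, by simp⟩
    | mul γ γ' _ _ h h' =>
      intro g
      obtain ⟨a, ha, h1⟩ := h' g
      obtain ⟨b, hb, h2⟩ := h (g * a)
      exact ⟨a * b, mul_mem ha hb, by rw [Equiv.Perm.mul_apply, h1, h2, mul_assoc]⟩
    | inv γ _ h =>
      intro g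
      obtain ⟨g', hg'⟩ := e.surjective (γ⁻¹ (e g))
      obtain ⟨a, ha, h1⟩ := h g'
      rw [hg', ← Equiv.Perm.mul_apply, mul_inv_cancel, Equiv.Perm.one_apply] at h1
      refine ⟨a⁻¹, inv_mem ha, ?_⟩
      rw [← hg', e.injective h1, mul_inv_cancel_right]
  rw [eq_top_iff]
  rintro g -
  obtain ⟨γ, hγ, h1⟩ := O.connected s₀ (e g)
  obtain ⟨a, ha, h2⟩ := key γ hγ 1
  rw [he, Subgroup.coe_one, Equiv.Perm.one_apply, h1, one_mul] at h2
  rw [e.injective h2]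
  exact ha

theorem exists_isAdmissible_trans [Finite S] {k q : ℕ} (hk : k ≠ 0) (hq : q ≠ 0)
    (hO : O.IsRegular) (hst : O.InStratum k (2 * q)) :
    ∃ x y : O.trans, IsAdmissible k q O.trans x y := by
  obtain ⟨x, y, e, hx, hy, hgen⟩ := O.exists_cayley_of_isRegular hO
  have hn := ncard_vertex_of_cayley e hx hy
  obtain ⟨h1, h2⟩ := (inStratum_iff_of_ncard hk (by omega) hn).1 hst
  have hadm : IsAdmissible k q O.autGroup x y :=
    ⟨by rw [Nat.card_congr e, h2]; ring, hgen, h1⟩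
  obtain ⟨s⟩ := O.nonempty
  -- As k + 1 ≥ 2, two squares share a lower left vertex, so translations are deck transformations.
  obtain ⟨s', hs', hne⟩ := Set.exists_ne_of_one_lt_ncard (s := {t | O.pt t 0 0 = O.pt s 0 0})
    (by rw [hn s, h1]; omega) s
  obtain ⟨E⟩ := O.nonempty_autGroup_mulEquiv_trans hne hs'
  exact ⟨E x, E y, hadm.of_mulEquiv E⟩

end Origami

/-! ### The classification. -/

theorem theorem6p9 (k q : ℕ) (hk : Odd k) (hq : q.Prime) (hq2 : q ≠ 2) :
    -- existence of regular origamis in `H(k ^ (2q))`, and their translation groups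
    (((∃ (S : Type u) (_ : Finite S) (O : Origami S), O.IsRegular ∧ O.InStratum k (2 * q)) ↔
        ArithCondition k q) ∧
      ∀ (S : Type u) [Finite S] (O : Origami S), O.IsRegular → O.InStratum k (2 * q) →
        (k % 4 = 1 → IsKleinType ((k + 1) / 2) O.trans) ∧
        (k % 4 = 3 → IsQuaternionType ((k + 1) / 4) O.trans)) ∧
    -- the same for the groups of order `2 (k + 1) q` with two generators
    (((∃ (G : Type u) (_ : Group G) (x y : G), IsAdmissible k q G x y) ↔
        ArithCondition k q) ∧
      ∀ (G : Type u) [Group G] (x y : G), IsAdmissible k q G x y →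
        (k % 4 = 1 → IsKleinType ((k + 1) / 2) G) ∧
        (k % 4 = 3 → IsQuaternionType ((k + 1) / 4) G)) := by
  have hk0 : k ≠ 0 := by
    rintro rfl
    simp at hk
  have harith : ∀ (G : Type u) [Group G] (x y : G), IsAdmissible k q G x y →
      ArithCondition k q := by
    intro G _ x y h
    obtain ⟨h3, h⟩ := h.eq_three_and_type hk hq hq2
    exact ⟨h3, h.imp (fun h => ⟨h.1, h.2.1⟩) fun h => ⟨h.1, h.2.1⟩⟩
  have htype : ∀ (G : Type u) [Group G] (x y : G), IsAdmissible k q G x y →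
      (k % 4 = 1 → IsKleinType ((k + 1) / 2) G) ∧
        (k % 4 = 3 → IsQuaternionType ((k + 1) / 4) G) := by
    intro G _ x y h
    obtain ⟨-, h | h⟩ := h.eq_three_and_type hk hq hq2
    · exact ⟨fun _ => h.2.2, fun h' => by omega⟩
    · exact ⟨fun h' => by omega, fun _ => h.2.2⟩
  refine ⟨⟨⟨?_, ?_⟩, ?_⟩, ⟨?_, exists_isAdmissible_of_arithCondition⟩, htype⟩
  · rintro ⟨S, _, O, hO, hst⟩
    obtain ⟨x, y, h⟩ := O.exists_isAdmissible_trans hk0 hq.ne_zero hO hst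
    exact harith _ x y h
  · intro h
    obtain ⟨G, _, x, y, hG⟩ := exists_isAdmissible_of_arithCondition.{u} h
    refine ⟨G, Nat.finite_of_card_ne_zero ?_, Origami.ofGroup x y hG.2.1,
      Origami.isRegular_ofGroup x y _, Origami.inStratum_ofGroup hk0 hq.ne_zero hG⟩
    rw [hG.1]
    have := hq.pos
    positivity
  · intro S _ O hO hst
    obtain ⟨x, y, h⟩ := O.exists_isAdmissible_trans hk0 hq.ne_zero hO hst
    exact htype _ x y h
  · rintro ⟨G, _, x, y, h⟩
    exact harith G x y h
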